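/- **Setting.** Let $G=(V,E)$ be a finite connected simple undirected graph and $K\ge 2$ an integer. Each edge $e$ has a time series of real weights at the instants $1,2,\dots,K$; its weight function $w_e:[1,K]\to\mathbb R$ is the linear interpolation of this series. No two different edges have equal weights at two consecutive instants. Hence immediately before and immediately after any time the weights of all edges are distinct and linearly ordered (the *order before*, resp. *after*, $t$). A *minimum spanning tree (MST) at time $t$* is a spanning tree $T$ of least total cost $\sum_{e\in T}w_e(t)$. An interval $[a,b]\subseteq[1,K]$ *has the unique MST $T$* if $T$ is the one and only tree that is an MST at every time of $[a,b]$. A *time-sub-interval* is a subinterval of $[1,K]$ that has a unique MST and is maximal with this property. A *bi-connected component* is a maximal nonempty set of edges any two of which lie on a common (simple) cycle. An *intersection point* at time $t$ is a point $(t,y)$ with $w_e(t)=y$ for at least two edges; the edges with $w_e(t)=y$ are the edges involved in it. **The edge intersection order (EIO) algorithm.** 1. *Initial tree (modified reverse-delete).* Start with all edges. While the remaining network has an edge outside a depth first search tree of it, pick such a non-tree edge and delete the heaviest edge, in the order after $t=1$, of the cycle that it closes with that tree; then take a depth first search tree of what is left. The edges that finally remain form the previous MST; its start time is $1$. 2.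 *Main loop.* Process the times $t\in(1,K)$ of intersection points in increasing order. At the beginning of time $t$ the MST-change flag is off. Process the intersection points at time $t$ one by one, in any order. Below, "tree edge" and "non-tree edge" refer to the previous MST. * Skip the point if all edges involved are tree edges, or all are non-tree edges, or they belong to pairwise different bi-connected components. * Otherwise group the edges involved by bi-connected components, and process the groups one by one, in any order. Skip a group that consists of tree edges only or of non-tree edges only. * Skip a group if its decreasing orders of weights $s_i$ before $t$ and $s_j$ after $t$ are the same. * For any other group set the MST-change flag and, if no current MST has been created yet at time $t$, create it as a copy of the previous MST. If the group has just two edges, and these lie on a common cycle of $G$ and neither of them lies on any other cycle of $G$, then remove the heavier one (in the order after $t$) from the current MST and insert the lighter one. In all other cases, for every edge of $s_j$ that is not in the current MST, in the order of $s_j$, add it to the current MST and delete the heaviest edge, in the order after $t$, of the cycle so created. After the last intersection point at time $t$, if the MST-change flag is set, output the previous MST with the interval from its start time to $t$; the current MST becomes the previous MST, with start time $t$. 3. *End.* Output the previous MST with the interval from its start time to $K$. **Theorem.** The EIO algorithm is correct: for every such network, and for all choices that the algorithm leaves open (depth first search trees, non-tree edges picked, order of the intersection points at one time and of the groups), the algorithm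 never gets stuck and stops after finitely many steps, and its output $(T_1,[a_1,b_1]),\dots,(T_r,[a_r,b_r])$ satisfies: * $a_1=1$, $b_r=K$, $b_i=a_{i+1}$ for $i<r$, and for every $i$ one has $a_i<b_i$ and $[a_i,b_i]$ has the unique MST $T_i$; * after consecutive items with the same tree have been combined into one (joining their intervals), the output is the list, in order of time and without repetition, of all the time-sub-intervals, each with its unique MST. -/

import Mathlib

open Filter Topology

namespace EdgeIntersectionOrder

/-- An undirected spatio-temporal network on the vertex set `V`: a connected graph in which
every edge carries a time series of weights at the instants `1, 2, …, K`. Two different edges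
never have equal weights at two consecutive instants. (Only the values of `series` at edges of
the graph and at the instants `1, …, K` are ever used.) -/
structure STNetwork (V : Type*) where
  graph : SimpleGraph V
  connected : graph.Connected
  K : ℕ
  two_le_K : 2 ≤ K
  series : Sym2 V → ℕ → ℝ
  no_common_segment : ∀ e ∈ graph.edgeSet, ∀ f ∈ graph.edgeSet, e ≠ f →
    ∀ k : ℕ, 1 ≤ k → k < K → ¬ (series e k = series f k ∧ series e (k + 1) = series f (k + 1))

/-- One item of output: a tree (as a set of edges) with the end points of its time interval. -/
@[ext] structure Entry (V : Type*) where
  tree : Finset (Sym2 V)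
  start : ℝ
  finish : ℝ

/-- The program variables of the main loop. The tree `cur` is meaningful only while
`newExists` is `true`. -/
structure State (V : Type*) where
  prev : Finset (Sym2 V)
  cur : Finset (Sym2 V)
  start : ℝ
  changed : Bool
  newExists : Bool
  out : List (Entry V)

/-- Program points of the algorithm, with the items that the loops still have to visit:
* `reverseDelete R`: the `while` loop computing the initial tree; `R` is the set of edges left;
* `times ts s`: the loop over the intersection times;
* `points t ps ts s`: the loop over the intersection points `ps` at time `t`;
* `groups t bs ps ts s`: the loop over the groups `bs` of edges of one intersection point;
* `edges t fs bs ps ts s`: the loop over the non-tree edges `fs` of one group;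
* `halted out`: the algorithm has stopped with output `out`. -/
inductive Config (V : Type*) where
  | reverseDelete (R : Finset (Sym2 V))
  | times (ts : List ℝ) (s : State V)
  | points (t : ℝ) (ps : List (Finset (Sym2 V))) (ts : List ℝ) (s : State V)
  | groups (t : ℝ) (bs : List (Finset (Sym2 V))) (ps : List (Finset (Sym2 V))) (ts : List ℝ)
      (s : State V)
  | edges (t : ℝ) (fs : List (Sym2 V)) (bs : List (Finset (Sym2 V)))
      (ps : List (Finset (Sym2 V))) (ts : List ℝ) (s : State V)
  | halted (out : List (Entry V))

/-- The list `l` runs through the objects with property `P`, each once, in some order. -/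
def Enumerates {α : Type*} (l : List α) (P : α → Prop) : Prop :=
  l.Nodup ∧ ∀ x, x ∈ l ↔ P x

namespace STNetwork

variable {V : Type*} (N : STNetwork V)

/-! ### Weights, spanning trees, time-sub-intervals -/

/-- The weight of the edge `e` at the real time `t ∈ [1, K]`: the linear interpolation of the
time series between consecutive instants. -/
noncomputable def weight (e : Sym2 V) (t : ℝ) : ℝ :=
  N.series e ⌊t⌋₊ + (t - ⌊t⌋₊) * (N.series e (⌊t⌋₊ + 1) - N.series e ⌊t⌋₊)

/-- The total cost of a set of edges at time `t`. -/
noncomputable def cost (T : Finset (Sym2 V)) (t : ℝ) : ℝ := ∑ e ∈ T, N.weight e t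

def IsSpanningTree (T : Finset (Sym2 V)) : Prop :=
  (T : Set (Sym2 V)) ⊆ N.graph.edgeSet ∧ (SimpleGraph.fromEdgeSet (T : Set (Sym2 V))).IsTree

/-- `T` is a minimum spanning tree of the network at time `t`. -/
def IsMST (t : ℝ) (T : Finset (Sym2 V)) : Prop :=
  N.IsSpanningTree T ∧ ∀ T', N.IsSpanningTree T' → N.cost T t ≤ N.cost T' t

/-- `T` is the one and only tree that is a minimum spanning tree throughout `[a, b]`. (At single
instants at which weights coincide there may be further trees of the same cost.) -/
def IsUniqueMSTOn (T : Finset (Sym2 V)) (a b : ℝ) : Prop :=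
  (∀ t ∈ Set.Icc a b, N.IsMST t T) ∧ ∀ T', (∀ t ∈ Set.Icc a b, N.IsMST t T') → T' = T

/-- `x` is a time-sub-interval together with its minimum spanning tree: the interval is a maximal
subinterval of the horizon `[1, K]` that has a unique minimum spanning tree. -/
def IsTimeSubInterval (x : Entry V) : Prop :=
  (1 ≤ x.start ∧ x.start ≤ x.finish ∧ x.finish ≤ N.K) ∧ N.IsUniqueMSTOn x.tree x.start x.finish ∧
    ∀ a b : ℝ, 1 ≤ a → a ≤ x.start → x.finish ≤ b → b ≤ N.K →
      (∃ T, N.IsUniqueMSTOn T a b) → a = x.start ∧ b = x.finish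

/-! ### The order of the edges before and after a time -/

/-- Immediately before time `t`, the edge `e` is lighter than `f`. -/
def LighterBefore (t : ℝ) (e f : Sym2 V) : Prop := ∀ᶠ s in 𝓝[<] t, N.weight e s < N.weight f s

/-- Immediately after time `t`, the edge `e` is lighter than `f`. If the weights at time `t`
differ, this is the comparison of the weights at time `t`. -/
def LighterAfter (t : ℝ) (e f : Sym2 V) : Prop := ∀ᶠ s in 𝓝[>] t, N.weight e s < N.weight f s

/-- `h` is the heaviest edge of `C`, in the order immediately after time `t`. -/
def IsHeaviest (t : ℝ) (C : Finset (Sym2 V)) (h : Sym2 V) : Prop :=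
  h ∈ C ∧ ∀ g ∈ C, g ≠ h → N.LighterAfter t g h

/-- `l` lists the edges of `b` in decreasing order of weight, where `lighter` compares weights. -/
def IsDecreasingOrder (lighter : Sym2 V → Sym2 V → Prop) (b : Finset (Sym2 V))
    (l : List (Sym2 V)) : Prop :=
  Enumerates l (· ∈ b) ∧ l.Pairwise (fun e f => lighter f e)

/-! ### Intersection points -/

/-- `p` is the set of all edges whose weight functions pass through one intersection point with
time coordinate `t`, that is, a point of the plane common to two or more weight functions. -/
def IsIntersectionPoint (t : ℝ) (p : Finset (Sym2 V)) : Prop :=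
  2 ≤ p.card ∧ ∃ y : ℝ, ∀ e, e ∈ p ↔ e ∈ N.graph.edgeSet ∧ N.weight e t = y

/-- The times strictly inside the horizon at which weight functions intersect. -/
def IsIntersectionTime (t : ℝ) : Prop :=
  1 < t ∧ t < N.K ∧ ∃ p, N.IsIntersectionPoint t p

/-! ### Cycles, bi-connected components, depth first search trees -/

/-- `C` is the edge set of a (simple) cycle of the network. -/
def IsCycle (C : Finset (Sym2 V)) : Prop :=
  ∃ (v : V) (c : N.graph.Walk v v), c.IsCycle ∧ ∀ e, e ∈ C ↔ e ∈ c.edges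

/-- A bi-connected component: a maximal nonempty set of edges any two of which lie on a common
cycle. -/
def IsBiconnectedComponent (B : Finset (Sym2 V)) : Prop :=
  Maximal (fun S : Finset (Sym2 V) => S.Nonempty ∧ (S : Set (Sym2 V)) ⊆ N.graph.edgeSet ∧
    ∀ e ∈ S, ∀ f ∈ S, e ≠ f → ∃ C, N.IsCycle C ∧ e ∈ C ∧ f ∈ C) B

/-- The edges of `p` belong to pairwise different bi-connected components. -/
def InDifferentComponents (p : Finset (Sym2 V)) : Prop :=
  ∀ e ∈ p, ∀ f ∈ p, e ≠ f → ¬ ∃ B, N.IsBiconnectedComponent B ∧ e ∈ B ∧ f ∈ B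

/-- The edges `e` and `f` lie on a common cycle, and neither lies on any other cycle. -/
def OnOnlyTheCommonCycle (e f : Sym2 V) : Prop :=
  ∃ C, (N.IsCycle C ∧ e ∈ C ∧ f ∈ C) ∧ ∀ C', N.IsCycle C' → (e ∈ C' ∨ f ∈ C') → C' = C

/-- In the tree with edge set `D`, rooted at `r`, the vertex `u` is an ancestor of `v` (or `v`
itself). -/
def IsAncestor (D : Finset (Sym2 V)) (r u v : V) : Prop :=
  ∃ p : (SimpleGraph.fromEdgeSet (D : Set (Sym2 V))).Walk r v, p.IsPath ∧ u ∈ p.support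

/-- `D` is a depth first search tree of the subnetwork with edge set `R`: a spanning tree that
can be rooted so that every edge of `R` joins a vertex with one of its ancestors. -/
def IsDFSTree (R D : Finset (Sym2 V)) : Prop :=
  D ⊆ R ∧ N.IsSpanningTree D ∧
    ∃ r : V, ∀ u v : V, s(u, v) ∈ R → IsAncestor D r u v ∨ IsAncestor D r v u

variable [DecidableEq V]

/-- The nonempty groups obtained from `p` by sorting its edges into bi-connected components. -/
def IsGroup (p b : Finset (Sym2 V)) : Prop :=
  b.Nonempty ∧ ∃ B, N.IsBiconnectedComponent B ∧ b = p ∩ B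

/-- `C` is the cycle that arises when the non-tree edge `f` is added to the tree `T`. -/
def IsFundamentalCycle (T : Finset (Sym2 V)) (f : Sym2 V) (C : Finset (Sym2 V)) : Prop :=
  N.IsCycle C ∧ f ∈ C ∧ C ⊆ insert f T

end STNetwork

/-! ### The algorithm -/

/-- All edges of `b` are tree edges of `T`, or all of them are non-tree edges. -/
def AllTreeOrAllNonTree {V : Type*} (T b : Finset (Sym2 V)) : Prop :=
  (∀ e ∈ b, e ∈ T) ∨ (∀ e ∈ b, e ∉ T)

/-- Set the MST-change flag; if no new tree exists yet, create one as a copy of the previous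
tree. -/
def State.beginUpdate {V : Type*} (s : State V) : State V :=
  { s with changed := true, cur := if s.newExists then s.cur else s.prev, newExists := true }

/-- At the end of time `t`: if the MST-change flag is set, output the previous tree with its
interval and make the current tree the previous one. -/
def State.report {V : Type*} (s : State V) (t : ℝ) : State V :=
  if s.changed then
    { s with out := s.out ++ [⟨s.prev, s.start, t⟩], prev := s.cur, start := t }
  else s

open STNetwork in
/-- One step of the edge intersection order algorithm on the network `N`. -/
inductive Step {V : Type*} [DecidableEq V] (N : STNetwork V) : Config V → Config V → Prop
  /-- Modified reverse-delete: find a depth first search tree `D` of the remaining edges, pick a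
  non-tree edge, and delete the heaviest edge of its cycle. -/
  | delete {R D C : Finset (Sym2 V)} {f h : Sym2 V} :
      N.IsDFSTree R D → f ∈ R → f ∉ D → N.IsFundamentalCycle D f C → N.IsHeaviest 1 C h →
      Step N (.reverseDelete R) (.reverseDelete (R.erase h))
  /-- No non-tree edge is left: the remaining edges are the first tree. The intersection times
  are sorted. -/
  | start {R D : Finset (Sym2 V)} {ts : List ℝ} :
      N.IsDFSTree R D → R ⊆ D → Enumerates ts N.IsIntersectionTime → ts.Pairwise (· < ·) →
      Step N (.reverseDelete R)
        (.times ts { prev := R, cur := R, start := 1, changed := false, newExists := false,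
                     out := [] })
  /-- Begin to process the time `t`. -/
  | beginTime {t : ℝ} {ts : List ℝ} {ps : List (Finset (Sym2 V))} {s : State V} :
      Enumerates ps (N.IsIntersectionPoint t) →
      Step N (.times (t :: ts) s)
        (.points t ps ts { s with changed := false, newExists := false })
  /-- Skip an intersection point that involves only tree edges, or only non-tree edges, or
  only edges of pairwise different bi-connected components. -/
  | prunePoint {t : ℝ} {p : Finset (Sym2 V)} {ps : List (Finset (Sym2 V))} {ts : List ℝ}
      {s : State V} :
      AllTreeOrAllNonTree s.prev p ∨ N.InDifferentComponents p →
      Step N (.points t (p :: ps) ts s) (.points t ps ts s)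
  /-- Otherwise group its edges by bi-connected components. -/
  | groupPoint {t : ℝ} {p : Finset (Sym2 V)} {bs ps : List (Finset (Sym2 V))} {ts : List ℝ}
      {s : State V} :
      ¬ (AllTreeOrAllNonTree s.prev p ∨ N.InDifferentComponents p) →
      Enumerates bs (N.IsGroup p) →
      Step N (.points t (p :: ps) ts s) (.groups t bs ps ts s)
  /-- Skip a group of tree edges only, or of non-tree edges only. -/
  | pruneGroup {t : ℝ} {b : Finset (Sym2 V)} {bs ps : List (Finset (Sym2 V))} {ts : List ℝ}
      {s : State V} :
      AllTreeOrAllNonTree s.prev b →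
      Step N (.groups t (b :: bs) ps ts s) (.groups t bs ps ts s)
  /-- Skip a group whose order of weights is the same before and after. -/
  | sameOrder {t : ℝ} {b : Finset (Sym2 V)} {bs ps : List (Finset (Sym2 V))} {ts : List ℝ}
      {si sj : List (Sym2 V)} {s : State V} :
      ¬ AllTreeOrAllNonTree s.prev b →
      IsDecreasingOrder (N.LighterBefore t) b si → IsDecreasingOrder (N.LighterAfter t) b sj →
      si = sj →
      Step N (.groups t (b :: bs) ps ts s) (.groups t bs ps ts s)
  /-- Only two edges, lying on their common cycle only: the heavier edge `h` leaves the tree,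
  the lighter edge `l` enters it. -/
  | swap {t : ℝ} {b : Finset (Sym2 V)} {bs ps : List (Finset (Sym2 V))} {ts : List ℝ}
      {si sj : List (Sym2 V)} {h l : Sym2 V} {s : State V} :
      ¬ AllTreeOrAllNonTree s.prev b →
      IsDecreasingOrder (N.LighterBefore t) b si → IsDecreasingOrder (N.LighterAfter t) b sj →
      si ≠ sj → sj = [h, l] → N.OnOnlyTheCommonCycle h l →
      Step N (.groups t (b :: bs) ps ts s)
        (.groups t bs ps ts { s.beginUpdate with cur := insert l (s.beginUpdate.cur.erase h) })
  /-- In all other cases the non-tree edges of the group will be added one by one. -/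
  | beginEdges {t : ℝ} {b : Finset (Sym2 V)} {bs ps : List (Finset (Sym2 V))} {ts : List ℝ}
      {si sj : List (Sym2 V)} {s : State V} :
      ¬ AllTreeOrAllNonTree s.prev b →
      IsDecreasingOrder (N.LighterBefore t) b si → IsDecreasingOrder (N.LighterAfter t) b sj →
      si ≠ sj → (¬ ∃ h l, sj = [h, l] ∧ N.OnOnlyTheCommonCycle h l) →
      Step N (.groups t (b :: bs) ps ts s)
        (.edges t (sj.filter (fun f => f ∉ s.beginUpdate.cur)) bs ps ts s.beginUpdate)
  /-- Add the non-tree edge `f` to the current tree and delete the heaviest edge of its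
  fundamental cycle. -/
  | addEdge {t : ℝ} {f h : Sym2 V} {C : Finset (Sym2 V)} {fs : List (Sym2 V)}
      {bs ps : List (Finset (Sym2 V))} {ts : List ℝ} {s : State V} :
      N.IsFundamentalCycle s.cur f C → N.IsHeaviest t C h →
      Step N (.edges t (f :: fs) bs ps ts s)
        (.edges t fs bs ps ts { s with cur := (insert f s.cur).erase h })
  | endEdges {t : ℝ} {bs ps : List (Finset (Sym2 V))} {ts : List ℝ} {s : State V} :
      Step N (.edges t [] bs ps ts s) (.groups t bs ps ts s)
  | endGroups {t : ℝ} {ps : List (Finset (Sym2 V))} {ts : List ℝ} {s : State V} :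
      Step N (.groups t [] ps ts s) (.points t ps ts s)
  | endTime {t : ℝ} {ts : List ℝ} {s : State V} :
      Step N (.points t [] ts s) (.times ts (s.report t))
  /-- Output the last tree with its interval and finish. -/
  | halt {s : State V} :
      Step N (.times [] s) (.halted (s.out ++ [⟨s.prev, s.start, (N.K : ℝ)⟩]))

/-- The initial configuration: no edge has been deleted yet. -/
noncomputable def initial {V : Type*} [Fintype V] (N : STNetwork V) : Config V :=
  .reverseDelete (Set.toFinite N.graph.edgeSet).toFinset

/-! ### Correct outputs -/

/-- Combine consecutive items with the same tree into one item. -/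
def combine {V : Type*} [DecidableEq V] : List (Entry V) → List (Entry V)
  | [] => []
  | x :: l =>
    match combine l with
    | [] => [x]
    | y :: l' => if x.tree = y.tree then ⟨x.tree, x.start, y.finish⟩ :: l' else x :: y :: l'

/-- What it means that `out` is a correct output. The intervals of the items follow one another
without gap from `1` to `K`, each item shows the unique minimum spanning tree of its interval, and,
once consecutive items with the same tree are combined, the list consists, in order of time and
without repetition, of all the time-sub-intervals with their minimum spanning trees. -/
structure IsCorrectOutput {V : Type*} [DecidableEq V] (N : STNetwork V) (out : List (Entry V)) :
    Prop where
  head : out.head?.map Entry.start = some 1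
  last : out.getLast?.map Entry.finish = some (N.K : ℝ)
  chain : out.IsChain (fun x y => x.finish = y.start)
  unique_mst : ∀ x ∈ out, x.start < x.finish ∧ N.IsUniqueMSTOn x.tree x.start x.finish
  sorted : (combine out).Pairwise (fun x y => x.finish ≤ y.start ∧ x.start < y.start)
  exact : ∀ x, x ∈ combine out ↔ N.IsTimeSubInterval x

end EdgeIntersectionOrder

/-! A spanning tree `T` is minimum exactly when every edge `f` is bypassed inside `T` by edges no
heavier than `f` (`SpansLight`, `isMST_iff`). Only the order of the weights enters this criterion.
Between consecutive intersection times continuity fixes the order, so sample times `s₁` and `s₂` on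
the two sides of `t` encode the orders before and after `t`, and a tree that is minimum at a sample
is minimum on the whole closed gap (`Gap.isMST`).

Let the previous tree be minimum at `s₁`. If `f` violates the criterion at `s₂`, then some tree edge
`e` on its bypass was lighter before `t` and is heavier after. So `e` and `f` meet at `t` and lie on
a common cycle (`Moment.spansLight_or_isInversion`); they share an intersection point and a group,
and no skipping test can discard that point or group. Inserting `f` and deleting the heaviest edge
`h` of its cycle repairs `f` and spoils no edge that was already good. Moreover `h` and `f` have
equal weight at `t`, so the tree stays minimum at `t` (`Moment.exchange`). Progress is therefore
monotone, the order of processing is irrelevant, and after the last point the current tree is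
minimum at `s₂`, hence up to the next intersection time.

The skipping tests consult the previous tree although updates change the current one. This matters
only for the two-edge shortcut: `PointsInv` and `GroupsInv` record that both trees still agree on
the edges concerned, and `Moment.swap` shows that the shortcut is an ordinary exchange.

Reverse-delete preserves the criterion just after time `1`. For the output, items tile `[1, K]`;
once equal neighbours are combined, a nondegenerate interval with a common minimum tree lies inside
a single item (`Tiles.exists_covering`), which yields maximality and completeness. -/

namespace EdgeIntersectionOrder

/-! ### Spanning trees, exchanges and the cycle criterion for minimality. -/

section Graph

variable {V : Type*}

/-- The end points of `e` are joined by a path with edges in `S`. -/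
def Connects (S : Set (Sym2 V)) (e : Sym2 V) : Prop :=
  ∀ u v, e = s(u, v) → (SimpleGraph.fromEdgeSet S).Reachable u v

theorem Connects.mk_iff {S : Set (Sym2 V)} {u v : V} :
    Connects S s(u, v) ↔ (SimpleGraph.fromEdgeSet S).Reachable u v := by
  refine ⟨fun h => h u v rfl, fun h a b hab => ?_⟩
  rcases Sym2.eq_iff.1 hab with ⟨rfl, rfl⟩ | ⟨rfl, rfl⟩
  · exact h
  · exact h.symm

theorem connects_of_mem {S : Set (Sym2 V)} {e : Sym2 V} (he : e ∈ S) : Connects S e := by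
  rintro u v rfl
  by_cases huv : u = v
  · subst huv; rfl
  · exact SimpleGraph.Adj.reachable ((SimpleGraph.fromEdgeSet_adj S).2 ⟨he, huv⟩)

theorem reachable_of_connects {S S' : Set (Sym2 V)} (h : ∀ e ∈ S, Connects S' e) {u v : V}
    (huv : (SimpleGraph.fromEdgeSet S).Reachable u v) :
    (SimpleGraph.fromEdgeSet S').Reachable u v := by
  obtain ⟨p⟩ := huv
  induction p with
  | nil => rfl
  | cons hadj _ ih => exact (h _ ((SimpleGraph.fromEdgeSet_adj S).1 hadj).1 _ _ rfl).trans ih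

theorem Connects.trans {S S' : Set (Sym2 V)} {f : Sym2 V} (hf : Connects S f)
    (h : ∀ e ∈ S, Connects S' e) : Connects S' f :=
  fun u v huv => reachable_of_connects h (hf u v huv)

theorem Connects.mono {S S' : Set (Sym2 V)} {f : Sym2 V} (hf : Connects S f) (h : S ⊆ S') :
    Connects S' f :=
  hf.trans fun _ he => connects_of_mem (h he)

/-- Every edge is joined by edges of `R` that are at most as heavy as it. -/
def SpansLight (w : Sym2 V → ℝ) (R : Set (Sym2 V)) (f : Sym2 V) : Prop :=
  Connects {e | e ∈ R ∧ w e ≤ w f} f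

namespace STNetwork

variable (N : STNetwork V)

theorem connected_of_connects {S : Set (Sym2 V)} (h : ∀ f ∈ N.graph.edgeSet, Connects S f) :
    (SimpleGraph.fromEdgeSet S).Connected := by
  have := N.connected.nonempty
  refine ⟨fun u v => reachable_of_connects (S := N.graph.edgeSet) h ?_⟩
  rw [SimpleGraph.fromEdgeSet_edgeSet]
  exact N.connected.preconnected u v

variable {N}

theorem IsSpanningTree.connects {T : Finset (Sym2 V)} (hT : N.IsSpanningTree T) (f : Sym2 V) :
    Connects (T : Set (Sym2 V)) f :=
  fun u v _ => hT.2.1.preconnected u v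

theorem edgeSet_fromEdgeSet_of_subset {S : Set (Sym2 V)} (hS : S ⊆ N.graph.edgeSet) :
    (SimpleGraph.fromEdgeSet S).edgeSet = S := by
  rw [SimpleGraph.edgeSet_fromEdgeSet]
  ext e
  simp only [Set.mem_sdiff, and_iff_left_iff_imp]
  exact fun he => N.graph.not_isDiag_of_mem_edgeSet (hS he)

theorem isSpanningTree_iff [Fintype V] {T : Finset (Sym2 V)} :
    N.IsSpanningTree T ↔ (T : Set (Sym2 V)) ⊆ N.graph.edgeSet ∧
      (∀ f ∈ N.graph.edgeSet, Connects (T : Set (Sym2 V)) f) ∧ T.card + 1 = Fintype.card V := by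
  refine and_congr_right fun hTE => ?_
  rw [SimpleGraph.isTree_iff_connected_and_card, edgeSet_fromEdgeSet_of_subset hTE, Nat.card_eq_fintype_card (α := V)]
  have hc : Nat.card (T : Set (Sym2 V)) = T.card := by simp
  rw [hc]
  exact and_congr_left fun _ =>
    ⟨fun h f _ u v _ => h.preconnected u v, fun h => N.connected_of_connects h⟩

theorem IsCycle.subset_edgeSet {C : Finset (Sym2 V)} (hC : N.IsCycle C) :
    (C : Set (Sym2 V)) ⊆ N.graph.edgeSet := by
  obtain ⟨v, c, -, h⟩ := hC
  exact fun e he => c.edges_subset_edgeSet ((h e).1 he)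

theorem IsCycle.connects {C : Finset (Sym2 V)} (hC : N.IsCycle C) {h : Sym2 V} (hh : h ∈ C) :
    Connects ((C : Set (Sym2 V)) \ {h}) h := by
  obtain ⟨v, c, hc, hCc⟩ := hC
  rintro a b rfl
  have hq : ∀ e ∈ c.edges, e ∈ (SimpleGraph.fromEdgeSet (C : Set (Sym2 V))).edgeSet := by
    intro e he
    rw [SimpleGraph.edgeSet_fromEdgeSet]
    exact ⟨(hCc e).2 he, N.graph.not_isDiag_of_mem_edgeSet (c.edges_subset_edgeSet he)⟩
  have := (SimpleGraph.adj_and_reachable_delete_edges_iff_exists_cycle (v := a) (w := b)).2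
    ⟨v, c.transfer _ hq, hc.transfer hq, by
      rw [SimpleGraph.Walk.edges_transfer]; exact (hCc _).1 hh⟩
  refine this.2.mono fun x y hxy => ?_
  simp only [SimpleGraph.deleteEdges_adj, SimpleGraph.fromEdgeSet_adj] at hxy ⊢
  exact ⟨⟨hxy.1.1, hxy.2⟩, hxy.1.2⟩

/-- A bypass that uses `h` can be rerouted along the rest of the cycle, whose edges are no heavier
than `h`. This serves both reverse-delete and the exchanges of the main loop. -/
theorem _root_.EdgeIntersectionOrder.SpansLight.erase {w : Sym2 V → ℝ} {R : Set (Sym2 V)} {f h : Sym2 V}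
    (hf : SpansLight w R f) {C : Finset (Sym2 V)} (hC : N.IsCycle C)
    (hCR : (C : Set (Sym2 V)) ⊆ R) (hh : h ∈ C) (hmax : ∀ g ∈ C, w g ≤ w h) :
    SpansLight w (R \ {h}) f := by
  refine Connects.trans hf fun e ⟨he, hef⟩ => ?_
  by_cases heh : e = h
  · subst heh
    exact (hC.connects hh).mono fun g hg => ⟨⟨hCR hg.1, hg.2⟩, (hmax g hg.1).trans hef⟩
  · exact connects_of_mem ⟨⟨he, heh⟩, hef⟩

variable [DecidableEq V]

/-- A path in `S` joining the end points of an edge outside of `S` closes a cycle with it. -/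
theorem exists_isCycle_of_connects {S : Set (Sym2 V)} (hS : S ⊆ N.graph.edgeSet) {f : Sym2 V}
    (hf : f ∈ N.graph.edgeSet) (hfS : f ∉ S) (h : Connects S f) :
    ∃ P : Finset (Sym2 V), (P : Set (Sym2 V)) ⊆ S ∧ Connects (P : Set (Sym2 V)) f ∧
      N.IsCycle (insert f P) := by
  induction f using Sym2.ind with | _ u v
  obtain ⟨q, hq⟩ := (h u v rfl).exists_isPath
  have hle : SimpleGraph.fromEdgeSet S ≤ N.graph := by
    intro a b hab
    exact hS ((SimpleGraph.fromEdgeSet_adj S).1 hab).1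
  have hqS : ∀ e ∈ q.edges, e ∈ S := by
    intro e he
    have := q.edges_subset_edgeSet he
    rw [SimpleGraph.edgeSet_fromEdgeSet] at this
    exact this.1
  refine ⟨q.edges.toFinset, fun e he => hqS e (by simpa using he), ?_, ?_⟩
  · rw [Connects.mk_iff]
    refine ⟨q.transfer _ fun e he => ?_⟩
    rw [SimpleGraph.edgeSet_fromEdgeSet]
    exact ⟨by simpa using he, N.graph.not_isDiag_of_mem_edgeSet (hS (hqS e he))⟩
  · have hvu : N.graph.Adj v u := SimpleGraph.Adj.symm hf
    refine ⟨v, SimpleGraph.Walk.cons hvu (q.mapLe hle), ?_, fun e => ?_⟩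
    · rw [SimpleGraph.Walk.cons_isCycle_iff, SimpleGraph.Walk.edges_mapLe_eq_edges]
      refine ⟨hq.mapLe hle, fun hmem => hfS (hqS _ ?_)⟩
      rwa [Sym2.eq_swap]
    · rw [SimpleGraph.Walk.edges_cons, SimpleGraph.Walk.edges_mapLe_eq_edges, List.mem_cons,
        Finset.mem_insert, List.mem_toFinset, Sym2.eq_swap]

theorem IsSpanningTree.exists_isFundamentalCycle {T : Finset (Sym2 V)} (hT : N.IsSpanningTree T)
    {f : Sym2 V} (hf : f ∈ N.graph.edgeSet) (hfT : f ∉ T) :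
    ∃ C, N.IsFundamentalCycle T f C := by
  obtain ⟨P, hPT, -, hP⟩ := exists_isCycle_of_connects hT.1 hf (by simpa using hfT) (hT.connects f)
  exact ⟨insert f P, hP, Finset.mem_insert_self _ _,
    Finset.insert_subset_insert _ (by exact_mod_cast hPT)⟩

theorem IsSpanningTree.exchange [Fintype V] {T C : Finset (Sym2 V)} {f h : Sym2 V}
    (hT : N.IsSpanningTree T) (hfT : f ∉ T) (hC : N.IsFundamentalCycle T f C) (hh : h ∈ C) :
    N.IsSpanningTree ((insert f T).erase h) := by
  rw [isSpanningTree_iff] at hT ⊢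
  obtain ⟨hTE, hconn, hcard⟩ := hT
  obtain ⟨hC, hfC, hCT⟩ := hC
  refine ⟨?_, fun g hg => ?_, ?_⟩
  · intro e he
    rw [Finset.mem_coe, Finset.mem_erase, Finset.mem_insert] at he
    rcases he.2 with rfl | he
    · exact hC.subset_edgeSet hfC
    · exact hTE he
  · refine (hconn g hg).trans fun e he => ?_
    by_cases heh : e = h
    · subst heh
      refine (hC.connects hh).mono fun x hx => ?_
      rw [Finset.mem_coe, Finset.mem_erase]
      exact ⟨hx.2, hCT hx.1⟩
    · refine connects_of_mem ?_
      rw [Finset.mem_coe, Finset.mem_erase]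
      exact ⟨heh, Finset.mem_insert_of_mem he⟩
  · rw [Finset.card_erase_of_mem (hCT hh), Finset.card_insert_of_notMem hfT]
    exact hcard

theorem sum_exchange {T : Finset (Sym2 V)} {f h : Sym2 V} (w : Sym2 V → ℝ) (hfT : f ∉ T)
    (hh : h ∈ insert f T) :
    ∑ e ∈ (insert f T).erase h, w e = ∑ e ∈ T, w e + w f - w h := by
  have := Finset.add_sum_erase _ w hh
  rw [Finset.sum_insert hfT] at this
  linarith

/-- Removing `f` cuts `T'` in two; the light bypass of `f` in `T` must cross this cut, and a
crossing edge can replace `f`. The new tree is one step closer to `T` and no more expensive. -/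
theorem IsSpanningTree.exists_exchange [Fintype V] {w : Sym2 V → ℝ} {T T' : Finset (Sym2 V)}
    (hT : N.IsSpanningTree T) (hT' : N.IsSpanningTree T') (hne : T' ≠ T)
    (hw : ∀ f ∈ N.graph.edgeSet, SpansLight w T f) :
    ∃ f ∈ T', f ∉ T ∧ ∃ e ∈ T, e ∉ T' ∧ w e ≤ w f ∧
      N.IsSpanningTree ((insert e T').erase f) := by
  have h1 := isSpanningTree_iff.1 hT
  have h2 := isSpanningTree_iff.1 hT'
  obtain ⟨f, hfT', hfT⟩ : ∃ f ∈ T', f ∉ T := by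
    by_contra! hcon
    exact hne (Finset.eq_of_subset_of_card_le hcon (by omega))
  refine ⟨f, hfT', hfT, ?_⟩
  have hfE := hT'.1 hfT'
  -- Otherwise `T'` without `f` would still be connected, with too few edges for the number of
  -- vertices.
  have hnot : ¬ Connects (T'.erase f : Set (Sym2 V)) f := by
    intro hcon
    have hsub : (T'.erase f : Set (Sym2 V)) ⊆ N.graph.edgeSet :=
      fun e he => hT'.1 (Finset.mem_of_mem_erase he)
    have hsp : (SimpleGraph.fromEdgeSet (T'.erase f : Set (Sym2 V))).Connected := by
      refine N.connected_of_connects fun g hg => (h2.2.1 g hg).trans fun e he => ?_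
      by_cases hef : e = f
      · rwa [hef]
      · exact connects_of_mem (Finset.mem_coe.2 (Finset.mem_erase.2 ⟨hef, he⟩))
    have hle := hsp.card_vert_le_card_edgeSet_add_one
    rw [edgeSet_fromEdgeSet_of_subset hsub, Nat.card_eq_fintype_card (α := V)] at hle
    have hc : Nat.card ((T'.erase f : Finset (Sym2 V)) : Set (Sym2 V)) = (T'.erase f).card := by
      rw [Nat.card_coe_set_eq, Set.ncard_coe_finset]
    have := Finset.card_erase_lt_of_mem hfT'
    omega
  induction f using Sym2.ind with | _ a b
  obtain ⟨q⟩ := hw _ hfE a b rfl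
  rw [Connects.mk_iff] at hnot
  -- The crossing edge leaves the component of `a` in `T'` without `f`.
  obtain ⟨d, -, hd1, hd2⟩ := q.exists_boundary_dart
    {x | (SimpleGraph.fromEdgeSet (T'.erase s(a, b) : Set (Sym2 V))).Reachable a x}
    (SimpleGraph.Reachable.refl a) hnot
  obtain ⟨⟨x, y⟩, hadj⟩ := d
  obtain ⟨⟨heT, hle⟩, hxy⟩ := (SimpleGraph.fromEdgeSet_adj _).1 hadj
  have key : ¬ Connects (T'.erase s(a, b) : Set (Sym2 V)) s(x, y) :=
    fun h => hd2 (SimpleGraph.Reachable.trans hd1 (Connects.mk_iff.1 h))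
  have heT' : s(x, y) ∉ T' := fun he =>
    key (connects_of_mem (Finset.mem_coe.2 (Finset.mem_erase.2 ⟨fun h => hfT (h ▸ heT), he⟩)))
  refine ⟨s(x, y), heT, heT', hle, ?_⟩
  obtain ⟨C, hC⟩ := hT'.exists_isFundamentalCycle (hT.1 heT) heT'
  -- If the fundamental cycle avoided `f`, it would join the ends of the new edge on one side of the
  -- cut.
  refine hT'.exchange heT' hC (by_contra fun hfC => key ?_)
  refine (hC.1.connects hC.2.1).mono fun g hg => ?_
  rw [Finset.mem_coe, Finset.mem_erase]
  exact ⟨fun h => hfC (h ▸ hg.1), (Finset.mem_insert.1 (hC.2.2 hg.1)).resolve_left hg.2⟩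

theorem IsSpanningTree.sum_le [Fintype V] {w : Sym2 V → ℝ} {T : Finset (Sym2 V)}
    (hT : N.IsSpanningTree T) (hw : ∀ f ∈ N.graph.edgeSet, SpansLight w T f)
    {T' : Finset (Sym2 V)} (hT' : N.IsSpanningTree T') : ∑ e ∈ T, w e ≤ ∑ e ∈ T', w e := by
  induction hn : (T' \ T).card using Nat.strong_induction_on generalizing T' with
  | _ n ih =>
    by_cases hne : T' = T
    · rw [hne]
    obtain ⟨f, hfT', hfT, e, heT, heT', hle, hsp⟩ := hT.exists_exchange hT' hne hw
    have hlt : (((insert e T').erase f) \ T).card < n := by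
      rw [← hn]
      refine Finset.card_lt_card ((Finset.ssubset_iff_of_subset fun g hg => ?_).2 ⟨f, ?_, ?_⟩) <;>
        grind
    have := ih _ hlt hsp rfl
    rw [sum_exchange w heT' (Finset.mem_insert_of_mem hfT')] at this
    linarith

/-- For necessity, an edge of a fundamental cycle heavier than the inserted edge could be exchanged
for it at a profit. Sufficiency holds by repeated exchange towards `T`, even when weights tie. -/
theorem isMST_iff [Fintype V] {t : ℝ} {T : Finset (Sym2 V)} :
    N.IsMST t T ↔ N.IsSpanningTree T ∧
      ∀ f ∈ N.graph.edgeSet, SpansLight (fun e => N.weight e t) T f := by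
  refine and_congr_right fun hT => ⟨fun h f hf => ?_, fun h T' hT' => hT.sum_le h hT'⟩
  by_cases hfT : f ∈ T
  · exact connects_of_mem ⟨hfT, le_rfl⟩
  obtain ⟨C, hC⟩ := hT.exists_isFundamentalCycle hf hfT
  refine (hC.1.connects hC.2.1).mono fun g hg => ?_
  have hgT := (Finset.mem_insert.1 (hC.2.2 hg.1)).resolve_left hg.2
  refine ⟨hgT, ?_⟩
  have := h _ (hT.exchange hfT hC hg.1)
  simp only [cost] at this
  rw [sum_exchange (fun e => N.weight e t) hfT (Finset.mem_insert_of_mem hgT)] at this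
  simp only
  linarith

theorem IsMST.eq_of_injOn [Fintype V] {t : ℝ} {T T' : Finset (Sym2 V)} (hT : N.IsMST t T)
    (hT' : N.IsMST t T') (hinj : Set.InjOn (fun e => N.weight e t) N.graph.edgeSet) :
    T' = T := by
  by_contra hne
  obtain ⟨f, hfT', hfT, e, heT, heT', hle, hsp⟩ :=
    hT.1.exists_exchange hT'.1 hne (isMST_iff.1 hT).2
  have hlt : N.weight e t < N.weight f t :=
    lt_of_le_of_ne hle fun h => hfT (hinj (hT.1.1 heT) (hT'.1.1 hfT') h ▸ heT)
  have := hT'.2 _ hsp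
  simp only [cost] at this
  rw [sum_exchange (fun e => N.weight e t) heT' (Finset.mem_insert_of_mem hfT')] at this
  linarith

theorem IsMST.exchange [Fintype V] {t : ℝ} {T C : Finset (Sym2 V)} {f h : Sym2 V}
    (hT : N.IsMST t T) (hfT : f ∉ T) (hC : N.IsFundamentalCycle T f C) (hh : h ∈ C)
    (hfh : N.weight f t ≤ N.weight h t) :
    N.weight h t = N.weight f t ∧ N.IsMST t ((insert f T).erase h) := by
  have hsp := hT.1.exchange hfT hC hh
  have hsum : N.cost ((insert f T).erase h) t = N.cost T t + N.weight f t - N.weight h t :=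
    sum_exchange (fun e => N.weight e t) hfT (hC.2.2 hh)
  have := hT.2 _ hsp
  exact ⟨by linarith, hsp, fun T' hT' => by linarith [hT.2 T' hT']⟩

end STNetwork

end Graph

/-! ### Piecewise linear weights and the constancy of their order between intersections. -/

namespace STNetwork

section Weight

variable {V : Type*} (N : STNetwork V)

theorem weight_eq (e : Sym2 V) (k : ℕ) {s : ℝ} (hs : s ∈ Set.Icc (k : ℝ) (k + 1)) :
    N.weight e s = N.series e k + (s - k) * (N.series e (k + 1) - N.series e k) := by
  rcases hs.2.lt_or_eq with h | h
  · rw [weight, (Nat.floor_eq_iff (k.cast_nonneg.trans hs.1)).2 ⟨hs.1, h⟩]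
  -- At the right end the floor already selects the next segment, but with interpolation factor
  -- zero.
  · have : ⌊s⌋₊ = k + 1 := by
      rw [h]; exact_mod_cast Nat.floor_natCast (R := ℝ) (k + 1)
    rw [weight, this, h]
    push_cast
    ring

theorem continuousOn_weight (e : Sym2 V) (n : ℕ) :
    ContinuousOn (N.weight e) (Set.Icc (0 : ℝ) n) := by
  induction n with
  | zero => simp
  | succ n ih =>
    have hn : (0 : ℝ) ≤ n := n.cast_nonneg
    rw [Nat.cast_succ, ← Set.Icc_union_Icc_eq_Icc hn (by linarith : (n : ℝ) ≤ n + 1)]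
    refine ih.union_of_isClosed ?_ isClosed_Icc isClosed_Icc
    refine ContinuousOn.congr ?_ fun s hs => N.weight_eq e n hs
    fun_prop

theorem continuousOn_weight_Icc (e : Sym2 V) {a b : ℝ} (ha : 1 ≤ a) (hb : b ≤ N.K) :
    ContinuousOn (N.weight e) (Set.Icc a b) :=
  (N.continuousOn_weight e N.K).mono (Set.Icc_subset_Icc (by linarith) hb)

theorem one_lt_K : (1 : ℝ) < N.K := by exact_mod_cast N.two_le_K

/-- The times at which two edges have the same weight. -/
def coincidences : Set ℝ :=
  {t | t ∈ Set.Icc (1 : ℝ) N.K ∧ ¬ Set.InjOn (fun e => N.weight e t) N.graph.edgeSet}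

/-- Two affine functions that agree at two times of a segment agree at both its ends, which the
network forbids. -/
theorem subsingleton_coincidences {e f : Sym2 V} (he : e ∈ N.graph.edgeSet)
    (hf : f ∈ N.graph.edgeSet) (hef : e ≠ f) {k : ℕ} (hk : 1 ≤ k) (hkK : k < N.K) :
    {t | t ∈ Set.Icc (k : ℝ) (k + 1) ∧ N.weight e t = N.weight f t}.Subsingleton := by
  rintro s ⟨hs, hse⟩ t ⟨ht, hte⟩
  rw [N.weight_eq e k hs, N.weight_eq f k hs] at hse
  rw [N.weight_eq e k ht, N.weight_eq f k ht] at hte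
  by_contra hst
  refine N.no_common_segment e he f hf hef k hk hkK ?_
  have h1 : (s - t) * ((N.series e (k + 1) - N.series e k) -
      (N.series f (k + 1) - N.series f k)) = 0 := by linarith
  have h2 := (mul_eq_zero.1 h1).resolve_left (sub_ne_zero.2 hst)
  have h3 : N.series e (k + 1) - N.series e k = N.series f (k + 1) - N.series f k := by linarith
  rw [h3] at hse
  constructor <;> linarith

theorem finite_coincidences [Finite V] : N.coincidences.Finite := by
  have hfin : (⋃ x : {x : (Sym2 V × Sym2 V) × Fin N.K // x.1.1 ∈ N.graph.edgeSet ∧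
      x.1.2 ∈ N.graph.edgeSet ∧ x.1.1 ≠ x.1.2 ∧ 1 ≤ (x.2 : ℕ)},
      {t : ℝ | t ∈ Set.Icc ((x.1.2 : ℕ) : ℝ) ((x.1.2 : ℕ) + 1) ∧
        N.weight x.1.1.1 t = N.weight x.1.1.2 t}).Finite :=
    Set.finite_iUnion fun x => (N.subsingleton_coincidences x.2.1 x.2.2.1 x.2.2.2.1 x.2.2.2.2
      x.1.2.2).finite
  refine hfin.subset ?_
  rintro t ⟨ht, hinj⟩
  simp only [Set.InjOn, not_forall] at hinj
  obtain ⟨e, he, f, hf, heq, hne⟩ := hinj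
  obtain ⟨k, hk, hkK, hkt⟩ : ∃ k : ℕ, 1 ≤ k ∧ k < N.K ∧ t ∈ Set.Icc (k : ℝ) (k + 1) := by
    rcases ht.2.lt_or_eq with h | h
    · exact ⟨⌊t⌋₊, Nat.le_floor (by exact_mod_cast ht.1), (Nat.floor_lt (by linarith [ht.1])).2 h,
        Nat.floor_le (by linarith [ht.1]), (Nat.lt_floor_add_one t).le⟩
    -- The time `K` starts no segment, so it is assigned to the segment ending there.
    · have h2 := N.two_le_K
      refine ⟨N.K - 1, by omega, by omega, ?_⟩
      rw [h, Nat.cast_sub (by omega)]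
      simp
  exact Set.mem_iUnion.2 ⟨⟨((e, f), ⟨k, hkK⟩), he, hf, hne, hk⟩, hkt, heq⟩

theorem exists_isIntersectionPoint_iff [Finite V] {t : ℝ} :
    (∃ p, N.IsIntersectionPoint t p) ↔
      ¬ Set.InjOn (fun e => N.weight e t) N.graph.edgeSet := by
  constructor
  · rintro ⟨p, hp, y, hy⟩ hinj
    obtain ⟨e, he, f, hf, hef⟩ := Finset.one_lt_card.1 hp
    exact hef (hinj ((hy e).1 he).1 ((hy f).1 hf).1 (((hy e).1 he).2.trans ((hy f).1 hf).2.symm))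
  · intro h
    simp only [Set.InjOn, not_forall] at h
    obtain ⟨e, he, f, hf, heq, hne⟩ := h
    refine ⟨(Set.toFinite {g | g ∈ N.graph.edgeSet ∧ N.weight g t = N.weight f t}).toFinset, ?_,
      N.weight f t, fun g => by simp⟩
    exact Finset.one_lt_card.2 ⟨e, by simpa using ⟨he, heq⟩, f, by simpa using hf, hne⟩

theorem isIntersectionTime_iff [Finite V] {t : ℝ} :
    N.IsIntersectionTime t ↔ t ∈ N.coincidences ∧ t ∈ Set.Ioo (1 : ℝ) N.K := by
  rw [IsIntersectionTime, exists_isIntersectionPoint_iff]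
  constructor
  · rintro ⟨h1, h2, h3⟩
    exact ⟨⟨⟨h1.le, h2.le⟩, h3⟩, h1, h2⟩
  · rintro ⟨⟨-, h3⟩, h1, h2⟩
    exact ⟨h1, h2, h3⟩

theorem exists_enumerates_isIntersectionTime [Finite V] :
    ∃ ts, Enumerates ts N.IsIntersectionTime ∧ ts.Pairwise (· < ·) := by
  have hfin : {t | N.IsIntersectionTime t}.Finite :=
    N.finite_coincidences.subset fun t ht => (N.isIntersectionTime_iff.1 ht).1
  exact ⟨hfin.toFinset.sort (· ≤ ·), ⟨Finset.sort_nodup _ _, fun x => by simp⟩,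
    (Finset.sortedLT_sort _).pairwise⟩

/-- No two edges have the same weight strictly between `a` and `b`. -/
structure Gap (a b : ℝ) : Prop where
  one_le : 1 ≤ a
  lt : a < b
  le_K : b ≤ N.K
  injOn : ∀ s ∈ Set.Ioo a b, Set.InjOn (fun e => N.weight e s) N.graph.edgeSet

theorem exists_injOn [Finite V] {a b : ℝ} (ha : 1 ≤ a) (hab : a < b) (hb : b ≤ N.K) :
    ∃ s ∈ Set.Ioo a b, Set.InjOn (fun e => N.weight e s) N.graph.edgeSet := by
  obtain ⟨s, hs, hsc⟩ := ((Set.Ioo_infinite hab).sdiff N.finite_coincidences).nonempty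
  exact ⟨s, hs, by_contra fun h => hsc ⟨⟨ha.trans hs.1.le, hs.2.le.trans hb⟩, h⟩⟩

variable {N}

namespace Gap

variable {a b s s' : ℝ} {e f : Sym2 V}

theorem weight_lt (h : N.Gap a b) (hs : s ∈ Set.Ioo a b) (hs' : s' ∈ Set.Ioo a b)
    (he : e ∈ N.graph.edgeSet) (hf : f ∈ N.graph.edgeSet) (hlt : N.weight e s < N.weight f s) :
    N.weight e s' < N.weight f s' := by
  by_contra! hle
  have hsub : Set.uIcc s s' ⊆ Set.Ioo a b := Set.OrdConnected.uIcc_subset inferInstance hs hs'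
  have hcont : ContinuousOn (fun x => N.weight f x - N.weight e x) (Set.uIcc s s') :=
    ((N.continuousOn_weight_Icc f h.one_le h.le_K).sub
      (N.continuousOn_weight_Icc e h.one_le h.le_K)).mono (hsub.trans Set.Ioo_subset_Icc_self)
  obtain ⟨z, hz, hz0⟩ := intermediate_value_uIcc hcont
    (show (0 : ℝ) ∈ _ from Set.mem_uIcc.2 (Or.inr ⟨by linarith, by linarith⟩))
  have hfe : f = e := h.injOn z (hsub hz) hf he (sub_eq_zero.1 hz0)
  exact hlt.ne (by rw [hfe])

/-- At the end points of a gap strict inequalities may become equalities, so only the weak order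
passes to the closure. -/
theorem weight_le (h : N.Gap a b) (hs : s ∈ Set.Ioo a b) (hs' : s' ∈ Set.Icc a b)
    (he : e ∈ N.graph.edgeSet) (hf : f ∈ N.graph.edgeSet) (hle : N.weight e s ≤ N.weight f s) :
    N.weight e s' ≤ N.weight f s' := by
  have hcl := closure_Ioo h.lt.ne
  refine le_on_closure (s := Set.Ioo a b) (f := N.weight e) (g := N.weight f) (fun x hx => ?_)
    ?_ ?_ (by rwa [hcl])
  · by_contra! hlt
    exact hle.not_gt (h.weight_lt hx hs hf he hlt)
  · rw [hcl]; exact N.continuousOn_weight_Icc e h.one_le h.le_K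
  · rw [hcl]; exact N.continuousOn_weight_Icc f h.one_le h.le_K

theorem lighterAfter_iff (h : N.Gap a b) (hs : s ∈ Set.Ioo a b)
    (he : e ∈ N.graph.edgeSet) (hf : f ∈ N.graph.edgeSet) :
    N.LighterAfter a e f ↔ N.weight e s < N.weight f s := by
  constructor
  · intro hl
    obtain ⟨x, hx, hxab⟩ := (hl.and (Ioo_mem_nhdsGT h.lt)).exists
    exact h.weight_lt hxab hs he hf hx
  · intro hl
    filter_upwards [Ioo_mem_nhdsGT h.lt] with x hx
    exact h.weight_lt hs hx he hf hl

theorem lighterBefore_iff (h : N.Gap a b) (hs : s ∈ Set.Ioo a b)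
    (he : e ∈ N.graph.edgeSet) (hf : f ∈ N.graph.edgeSet) :
    N.LighterBefore b e f ↔ N.weight e s < N.weight f s := by
  constructor
  · intro hl
    obtain ⟨x, hx, hxab⟩ := (hl.and (Ioo_mem_nhdsLT h.lt)).exists
    exact h.weight_lt hxab hs he hf hx
  · intro hl
    filter_upwards [Ioo_mem_nhdsLT h.lt] with x hx
    exact h.weight_lt hs hx he hf hl

theorem nonempty (h : N.Gap a b) : (Set.Ioo a b).Nonempty := Set.nonempty_Ioo.2 h.lt

theorem isMST [Fintype V] [DecidableEq V] (h : N.Gap a b) (hs : s ∈ Set.Ioo a b)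
    {T : Finset (Sym2 V)} (hT : N.IsMST s T) (hs' : s' ∈ Set.Icc a b) : N.IsMST s' T := by
  refine isMST_iff.2 ⟨hT.1, fun f hf => ?_⟩
  exact ((isMST_iff.1 hT).2 f hf).mono fun e he =>
    ⟨he.1, h.weight_le hs hs' (hT.1.1 he.1) hf he.2⟩

theorem of_forall_notMem_isIntersectionTime [Finite V] (ha : 1 ≤ a) (hab : a < b) (hb : b ≤ N.K)
    (h : ∀ t ∈ Set.Ioo a b, ¬ N.IsIntersectionTime t) : N.Gap a b := by
  refine ⟨ha, hab, hb, fun s hs => by_contra fun hinj => h s hs ?_⟩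
  exact ⟨ha.trans_lt hs.1, hs.2.trans_le hb, N.exists_isIntersectionPoint_iff.2 hinj⟩

end Gap

/-- Uniqueness is automatic on a nondegenerate interval: it contains a time at which all weights are
distinct. -/
theorem isUniqueMSTOn_iff [Fintype V] [DecidableEq V] {a b : ℝ} (ha : 1 ≤ a) (hab : a < b)
    (hb : b ≤ N.K) {T : Finset (Sym2 V)} :
    N.IsUniqueMSTOn T a b ↔ ∀ t ∈ Set.Icc a b, N.IsMST t T := by
  refine ⟨fun h => h.1, fun h => ⟨h, fun T' hT' => ?_⟩⟩
  obtain ⟨s, hs, hinj⟩ := N.exists_injOn ha hab hb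
  exact (h s (Set.Ioo_subset_Icc_self hs)).eq_of_injOn (hT' s (Set.Ioo_subset_Icc_self hs)) hinj

end Weight

end STNetwork

/-! ### Existence of depth first search trees. -/

namespace STNetwork

section DepthFirstSearch

variable {V : Type*} {N : STNetwork V}

theorem IsAncestor.mono {D D' : Finset (Sym2 V)} (h : D ⊆ D') {r u v : V}
    (huv : IsAncestor D r u v) : IsAncestor D' r u v := by
  obtain ⟨p, hp, hu⟩ := huv
  have hle : SimpleGraph.fromEdgeSet (D : Set (Sym2 V)) ≤ SimpleGraph.fromEdgeSet D' :=
    SimpleGraph.fromEdgeSet_mono (Finset.coe_subset.2 h)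
  exact ⟨p.mapLe hle, hp.mapLe hle, by simpa using hu⟩

/-- A depth first search in progress: `S` is the set of visited vertices, `D` the tree built so
far, and the path `q` from the current vertex back to the root `r` is the stack. -/
structure IsPartialDFS (R : Finset (Sym2 V)) (S : Finset V) (D : Finset (Sym2 V)) {u r : V}
    (q : (SimpleGraph.fromEdgeSet (D : Set (Sym2 V))).Walk u r) : Prop where
  subset : D ⊆ R
  mem_of_mem : ∀ e ∈ D, ∀ x ∈ e, x ∈ S
  card : D.card + 1 = S.card
  reachable : ∀ v ∈ S, (SimpleGraph.fromEdgeSet (D : Set (Sym2 V))).Reachable r v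
  comparable : ∀ x ∈ S, ∀ y ∈ S, s(x, y) ∈ R → IsAncestor D r x y ∨ IsAncestor D r y x
  isPath : q.IsPath
  support_subset : ∀ x ∈ q.support, x ∈ S
  frontier : ∀ x ∈ S, ∀ y ∉ S, s(x, y) ∈ R → x ∈ q.support

/-- By `frontier`, every visited neighbour of the new vertex is still on the stack, hence an
ancestor of it. -/
theorem IsPartialDFS.push [DecidableEq V] {R : Finset (Sym2 V)} {S : Finset V}
    {D : Finset (Sym2 V)} {u r w : V}
    {q : (SimpleGraph.fromEdgeSet (D : Set (Sym2 V))).Walk u r} (h : IsPartialDFS R S D q)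
    (hw : w ∉ S) (huw : s(u, w) ∈ R) :
    ∃ q' : (SimpleGraph.fromEdgeSet (insert s(w, u) D : Finset (Sym2 V)) :
      SimpleGraph V).Walk w r, IsPartialDFS R (insert w S) (insert s(w, u) D) q' := by
  have huS : u ∈ S := h.support_subset u q.start_mem_support
  have hwu : w ≠ u := fun h => hw (h ▸ huS)
  have hsub : D ⊆ insert s(w, u) D := Finset.subset_insert _ _
  have hle : SimpleGraph.fromEdgeSet (D : Set (Sym2 V)) ≤
      SimpleGraph.fromEdgeSet (insert s(w, u) D : Finset (Sym2 V)) :=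
    SimpleGraph.fromEdgeSet_mono (Finset.coe_subset.2 hsub)
  have hadj : (SimpleGraph.fromEdgeSet ((insert s(w, u) D : Finset (Sym2 V)) :
      Set (Sym2 V))).Adj w u :=
    (SimpleGraph.fromEdgeSet_adj _).2 ⟨Finset.mem_coe.2 (Finset.mem_insert_self _ _), hwu⟩
  set q' := SimpleGraph.Walk.cons hadj (q.mapLe hle) with hq'
  have hsupp : ∀ x, x ∈ q'.support ↔ x = w ∨ x ∈ q.support := by
    intro x; simp [hq']
  have hpath : q'.IsPath := by
    rw [hq', SimpleGraph.Walk.cons_isPath_iff]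
    exact ⟨h.isPath.mapLe hle, fun hmem => hw (h.support_subset w (by simpa using hmem))⟩
  have hanc : ∀ x, x ∈ q'.support → IsAncestor (insert s(w, u) D) r x w := fun x hx =>
    ⟨q'.reverse, hpath.reverse, by simpa using hx⟩
  refine ⟨q', ⟨?_, ?_, ?_, ?_, ?_, hpath, ?_, ?_⟩⟩
  · exact Finset.insert_subset (by rwa [Sym2.eq_swap]) h.subset
  · intro e he x hx
    rcases Finset.mem_insert.1 he with rfl | he
    · rcases Sym2.mem_iff.1 hx with rfl | rfl
      · exact Finset.mem_insert_self _ _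
      · exact Finset.mem_insert_of_mem huS
    · exact Finset.mem_insert_of_mem (h.mem_of_mem e he x hx)
  · rw [Finset.card_insert_of_notMem hw, Finset.card_insert_of_notMem, h.card]
    exact fun he => hw (h.mem_of_mem _ he w (Sym2.mem_mk_left _ _))
  · intro v hv
    rcases Finset.mem_insert.1 hv with rfl | hv
    · exact ⟨q'.reverse⟩
    · exact (h.reachable v hv).mono hle
  · intro x hx y hy hxy
    rcases Finset.mem_insert.1 hx with rfl | hxS
    · rcases Finset.mem_insert.1 hy with rfl | hyS
      · exact Or.inl (hanc y q'.start_mem_support)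
      · exact Or.inr (hanc y ((hsupp y).2 (Or.inr (h.frontier y hyS x hw (by
          rwa [Sym2.eq_swap])))))
    · rcases Finset.mem_insert.1 hy with rfl | hyS
      · exact Or.inl (hanc x ((hsupp x).2 (Or.inr (h.frontier x hxS y hw hxy))))
      · exact (h.comparable x hxS y hyS hxy).imp (·.mono hsub) (·.mono hsub)
  · intro x hx
    rcases (hsupp x).1 hx with rfl | hx
    · exact Finset.mem_insert_self _ _
    · exact Finset.mem_insert_of_mem (h.support_subset x hx)
  · intro x hx y hy hxy
    rw [hsupp]
    exact (Finset.mem_insert.1 hx).imp id fun hx =>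
      h.frontier x hx y (fun h => hy (Finset.mem_insert_of_mem h)) hxy

theorem IsPartialDFS.exists_isDFSTree [Fintype V] [DecidableEq V] {R : Finset (Sym2 V)}
    (hR : (R : Set (Sym2 V)) ⊆ N.graph.edgeSet)
    (hconn : ∀ f ∈ N.graph.edgeSet, Connects (R : Set (Sym2 V)) f) {S : Finset V}
    {D : Finset (Sym2 V)} {u r : V}
    {q : (SimpleGraph.fromEdgeSet (D : Set (Sym2 V))).Walk u r} (h : IsPartialDFS R S D q) :
    ∃ D, N.IsDFSTree R D := by
  induction hn : Sᶜ.card generalizing S D u with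
  | zero =>
    have hS : ∀ x, x ∈ S := by simpa [Finset.eq_univ_iff_forall] using hn
    refine ⟨D, h.subset, isSpanningTree_iff.2
      ⟨fun e he => hR (h.subset he), fun f _ a b _ => ?_, ?_⟩, r, fun x y hxy => ?_⟩
    · exact (h.reachable a (hS a)).symm.trans (h.reachable b (hS b))
    · rw [h.card, Finset.eq_univ_iff_forall.2 hS, Finset.card_univ]
    · exact h.comparable x (hS x) y (hS y) hxy
  | succ n ih =>
    have step : ∀ {u w : V} {q : (SimpleGraph.fromEdgeSet (D : Set (Sym2 V))).Walk u r},
        IsPartialDFS R S D q → w ∉ S → s(u, w) ∈ R → ∃ D, N.IsDFSTree R D := by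
      intro u w q h hw huw
      obtain ⟨q', hq'⟩ := h.push hw huw
      refine ih hq' ?_
      rw [Finset.compl_insert, Finset.card_erase_of_mem (Finset.mem_compl.2 hw), hn]
      rfl
    -- Induction on the stack models backtracking: the current vertex is popped when all its
    -- neighbours are visited.
    induction q with
    | nil =>
      rename_i r
      obtain ⟨w, hw⟩ : Sᶜ.Nonempty := Finset.card_pos.1 (by omega)
      -- Only the root is on the stack. Connectedness gives an edge leaving the visited set, and
      -- `frontier` forces it to start at the root.
      obtain ⟨p⟩ := (N.connected_of_connects hconn).preconnected r w
      obtain ⟨⟨⟨x, y⟩, hxy⟩, -, hx, hy⟩ := p.exists_boundary_dart S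
        (h.support_subset r (by simp)) (Finset.mem_compl.1 hw)
      have hxyR : s(x, y) ∈ R := ((SimpleGraph.fromEdgeSet_adj _).1 hxy).1
      have : x = r := by simpa using h.frontier x hx y hy hxyR
      exact step h hy (this ▸ hxyR)
    | cons hadj q ihq =>
      rename_i u v r
      by_cases hu : ∃ w ∉ S, s(u, w) ∈ R
      · obtain ⟨w, hw, huw⟩ := hu
        exact step h hw huw
      · push Not at hu
        refine ihq ih ⟨h.subset, h.mem_of_mem, h.card, h.reachable, h.comparable, h.isPath.of_cons,
          fun x hx => h.support_subset x (by simp [hx]), fun x hx y hy hxy => ?_⟩ step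
        have := h.frontier x hx y hy hxy
        rw [SimpleGraph.Walk.support_cons, List.mem_cons] at this
        exact this.resolve_left fun hxu => hu y hy (hxu ▸ hxy)

/-- Every connected spanning subnetwork has a depth first search tree. -/
theorem exists_isDFSTree [Fintype V] [DecidableEq V] {R : Finset (Sym2 V)}
    (hR : (R : Set (Sym2 V)) ⊆ N.graph.edgeSet)
    (hconn : ∀ f ∈ N.graph.edgeSet, Connects (R : Set (Sym2 V)) f) :
    ∃ D, N.IsDFSTree R D := by
  obtain ⟨r⟩ := N.connected.nonempty
  refine IsPartialDFS.exists_isDFSTree hR hconn (S := {r}) (D := ∅) (u := r) (r := r)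
    (q := .nil) ⟨by simp, by simp, by simp, ?_, ?_, by simp, by simp, ?_⟩
  · intro v hv
    rw [Finset.mem_singleton.1 hv]
  · intro x hx y hy _
    rw [Finset.mem_singleton.1 hx, Finset.mem_singleton.1 hy]
    exact Or.inl ⟨.nil, by simp, by simp⟩
  · intro x hx y _ _
    simpa using hx

end DepthFirstSearch

end STNetwork

/-! ### Tilings of the horizon and the correctness of combined output. -/

section Output

variable {V : Type*}

/-- The intervals of the items follow one another from `a` to `b`, and each item shows a tree
that is a minimum spanning tree throughout its nondegenerate interval. -/
def Tiles (N : STNetwork V) (b : ℝ) : ℝ → List (Entry V) → Prop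
  | a, [] => a = b
  | a, x :: l => x.start = a ∧ x.start < x.finish ∧
      (∀ t ∈ Set.Icc x.start x.finish, N.IsMST t x.tree) ∧ Tiles N b x.finish l

namespace Tiles

variable {N : STNetwork V} {a b c : ℝ} {l : List (Entry V)}

theorem concat (h : Tiles N b a l) {x : Entry V} (hx : x.start = b) (hlt : x.start < x.finish)
    (hM : ∀ t ∈ Set.Icc x.start x.finish, N.IsMST t x.tree) :
    Tiles N x.finish a (l ++ [x]) := by
  induction l generalizing a with
  | nil => exact ⟨hx.trans h.symm, hlt, hM, rfl⟩
  | cons y l ih => exact ⟨h.1, h.2.1, h.2.2.1, ih h.2.2.2⟩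

theorem le (h : Tiles N b a l) : a ≤ b := by
  induction l generalizing a with
  | nil => exact h.le
  | cons y l ih => exact (h.1.symm.trans_lt h.2.1).le.trans (ih h.2.2.2)

theorem of_mem (h : Tiles N b a l) {x : Entry V} (hx : x ∈ l) :
    a ≤ x.start ∧ x.start < x.finish ∧ x.finish ≤ b ∧
      ∀ t ∈ Set.Icc x.start x.finish, N.IsMST t x.tree := by
  induction l generalizing a with
  | nil => simp at hx
  | cons y l ih =>
    obtain ⟨h1, h2, h3, h4⟩ := h
    rcases List.mem_cons.1 hx with rfl | hx
    · exact ⟨h1.ge, h2, h4.le, h3⟩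
    · obtain ⟨h5, h6⟩ := ih h4 hx
      exact ⟨by linarith, h6⟩

theorem pairwise (h : Tiles N b a l) :
    l.Pairwise (fun x y => x.finish ≤ y.start ∧ x.start < y.start) := by
  induction l generalizing a with
  | nil => exact List.Pairwise.nil
  | cons x l ih =>
    refine List.Pairwise.cons (fun y hy => ?_) (ih h.2.2.2)
    have := (h.2.2.2.of_mem hy).1
    exact ⟨this, h.2.1.trans_le this⟩

theorem isChain (h : Tiles N b a l) : l.IsChain (fun x y => x.finish = y.start) := by
  induction l generalizing a with
  | nil => exact List.IsChain.nil
  | cons x l ih =>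
    cases l with
    | nil => exact List.IsChain.singleton x
    | cons y l => exact List.IsChain.cons_cons h.2.2.2.1.symm (ih h.2.2.2)

theorem head_start (h : Tiles N b a l) (hab : a < b) :
    l.head?.map Entry.start = some a := by
  cases l with
  | nil => exact absurd h hab.ne
  | cons x l => simpa using h.1

theorem getLast_finish (h : Tiles N b a l) (hab : a < b) :
    l.getLast?.map Entry.finish = some b := by
  induction l generalizing a with
  | nil => exact absurd h hab.ne
  | cons x l ih =>
    cases l with
    | nil => exact congrArg some h.2.2.2
    | cons y l =>
      rw [List.getLast?_cons_cons]
      have h' := h.2.2.2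
      exact ih h' (h'.1.symm.trans_lt (h'.2.1.trans_le h'.2.2.2.le))

theorem eq_of_subset (h : Tiles N b a l) {x y : Entry V} (hx : x ∈ l) (hy : y ∈ l)
    (h1 : y.start ≤ x.start) (h2 : x.finish ≤ y.finish) : x = y := by
  by_contra hne
  have hxl := (h.of_mem hx).2.1
  have hyl := (h.of_mem hy).2.1
  have hsep : x = y ∨ x.finish ≤ y.start ∨ y.finish ≤ x.start :=
    List.Pairwise.forall_of_forall_of_flip
      (R := fun x y : Entry V => x = y ∨ x.finish ≤ y.start ∨ y.finish ≤ x.start)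
      (fun _ _ => Or.inl rfl) (h.pairwise.imp fun h => Or.inr (Or.inl h.1))
      (h.pairwise.imp fun h => Or.inr (Or.inr h.1)) hx hy
  rcases hsep.resolve_left hne with h3 | h3 <;> linarith

theorem exists_mem_Icc (h : Tiles N b a l) (hab : a < b) {t : ℝ} (ht : t ∈ Set.Icc a b) :
    ∃ x ∈ l, t ∈ Set.Icc x.start x.finish := by
  induction l generalizing a with
  | nil => exact absurd h hab.ne
  | cons x l ih =>
    rcases le_or_gt t x.finish with htx | htx
    · exact ⟨x, List.mem_cons_self, h.1.trans_le ht.1, htx⟩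
    · obtain ⟨y, hy, hty⟩ := ih h.2.2.2 (htx.trans_le ht.2) ⟨htx.le, ht.2⟩
      exact ⟨y, List.mem_cons_of_mem _ hy, hty⟩

variable [DecidableEq V]

theorem combine (h : Tiles N b a l) : Tiles N b a (combine l) := by
  induction l generalizing a with
  | nil => exact h
  | cons x l ih =>
    obtain ⟨h1, h2, h3, h4⟩ := h
    have := ih h4
    rw [EdgeIntersectionOrder.combine]
    cases hc : EdgeIntersectionOrder.combine l with
    | nil =>
      rw [hc] at this
      exact ⟨h1, h2, h3, this⟩
    | cons y l' =>
      rw [hc] at this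
      obtain ⟨h5, h6, h7, h8⟩ := this
      dsimp only
      split_ifs with hxy
      · refine ⟨h1, h2.trans (h5 ▸ h6), fun t ht => ?_, h8⟩
        rcases le_total t x.finish with htx | htx
        · exact h3 t ⟨ht.1, htx⟩
        · rw [hxy]; exact h7 t ⟨h5.trans_le htx, ht.2⟩
      · exact ⟨h1, h2, h3, h5, h6, h7, h8⟩

theorem _root_.EdgeIntersectionOrder.isChain_combine (l : List (Entry V)) :
    (EdgeIntersectionOrder.combine l).IsChain (fun x y => x.tree ≠ y.tree) := by
  induction l with
  | nil => exact List.IsChain.nil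
  | cons x l ih =>
    rw [EdgeIntersectionOrder.combine]
    cases hc : EdgeIntersectionOrder.combine l with
    | nil => exact List.IsChain.singleton x
    | cons y l' =>
      rw [hc] at ih
      dsimp only
      split_ifs with hxy
      · cases l' with
        | nil => exact List.IsChain.singleton _
        | cons z l' =>
          rw [List.isChain_cons_cons] at ih ⊢
          exact ⟨by rw [hxy]; exact ih.1, ih.2⟩
      · exact List.IsChain.cons_cons hxy ih

variable [Fintype V]

/-- If neighbouring trees differ, then an interval with a minimum spanning tree lies within the
interval of one item. -/
theorem exists_covering (h : Tiles N b a l) (ha : 1 ≤ a) (hb : b ≤ N.K)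
    (hl : l.IsChain (fun x y => x.tree ≠ y.tree)) {c d : ℝ} (hc : a ≤ c) (hcd : c < d)
    (hd : d ≤ b) {T : Finset (Sym2 V)} (hT : ∀ t ∈ Set.Icc c d, N.IsMST t T) :
    ∃ y ∈ l, y.start ≤ c ∧ d ≤ y.finish ∧ y.tree = T := by
  induction l generalizing a c with
  | nil => exact absurd h (hc.trans_lt (hcd.trans_le hd)).ne
  | cons x l ih =>
    obtain ⟨h1, h2, h3, h4⟩ := h
    have hxb := h4.le
    have hl' := hl.tail
    -- On any nondegenerate overlap both trees are minimum, so they coincide.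
    have key : ∀ {p q : ℝ}, c ≤ p → x.start ≤ p → p < q → q ≤ d → q ≤ x.finish →
        x.tree = T := by
      intro p q h5 h6 h7 h8 h9
      have hu := (N.isUniqueMSTOn_iff (h1 ▸ h6 |>.trans' ha) h7 (by linarith)).2
        fun t ht => hT t ⟨h5.trans ht.1, ht.2.trans h8⟩
      exact hu.2 _ fun t ht => h3 t ⟨h6.trans ht.1, ht.2.trans h9⟩
    rcases le_or_gt d x.finish with hdx | hdx
    · exact ⟨x, List.mem_cons_self, by linarith, hdx, key le_rfl (by linarith) hcd le_rfl hdx⟩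
    rcases le_or_gt x.finish c with hxc | hxc
    · obtain ⟨y, hy, hy'⟩ := ih h4 (by linarith) hl' hxc hcd hT
      exact ⟨y, List.mem_cons_of_mem _ hy, hy'⟩
    -- The interval would cross the boundary at `x.finish`. Then both `x` and the item covering the
    -- remainder carry `T`; that item must be the next one, yet neighbouring trees differ.
    · have hxT := key le_rfl (by linarith) hxc hdx.le le_rfl
      obtain ⟨y, hy, hy1, hy2, hyT⟩ := ih h4 (by linarith) hl' le_rfl hdx
        fun t ht => hT t ⟨hxc.le.trans ht.1, ht.2⟩
      exfalso
      cases l with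
      | nil => simp at hy
      | cons z l =>
        rcases List.mem_cons.1 hy with rfl | hyl
        · exact (List.isChain_cons_cons.1 hl).1 (hxT.trans hyT.symm)
        · have := (h4.2.2.2.of_mem hyl).1
          linarith [h4.1, h4.2.1]

theorem isCorrectOutput (h : Tiles N N.K 1 l) : IsCorrectOutput N l := by
  have h1K := N.one_lt_K
  refine ⟨h.head_start h1K, h.getLast_finish h1K, h.isChain, fun x hx => ?_, h.combine.pairwise,
    fun x => ?_⟩
  · obtain ⟨h1, h2, h3, h4⟩ := h.of_mem hx
    exact ⟨h2, (N.isUniqueMSTOn_iff h1 h2 h3).2 h4⟩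
  have hc := h.combine
  have hch := isChain_combine l
  constructor
  · intro hx
    obtain ⟨h1, h2, h3, h4⟩ := hc.of_mem hx
    refine ⟨⟨h1, h2.le, h3⟩, (N.isUniqueMSTOn_iff h1 h2 h3).2 h4, ?_⟩
    rintro a b ha hax hxb hb ⟨T, hT⟩
    obtain ⟨y, hy, hya, hyb, -⟩ :=
      hc.exists_covering le_rfl le_rfl hch ha (by linarith) hb hT.1
    have := hc.eq_of_subset hx hy (hya.trans hax) (hxb.trans hyb)
    subst this
    exact ⟨le_antisymm hax hya, le_antisymm hyb hxb⟩
  · rintro ⟨⟨h1, h2, h3⟩, hu, hmax⟩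
    have hmem : ∀ y ∈ EdgeIntersectionOrder.combine l, y.start ≤ x.start →
        x.finish ≤ y.finish → y.start = x.start ∧ y.finish = x.finish := by
      intro y hy h4 h5
      obtain ⟨h6, h7, h8, h9⟩ := hc.of_mem hy
      exact hmax _ _ h6 h4 h5 h8 ⟨y.tree, (N.isUniqueMSTOn_iff h6 h7 h8).2 h9⟩
    rcases h2.lt_or_eq with hlt | heq
    · obtain ⟨y, hy, h4, h5, h6⟩ := hc.exists_covering le_rfl le_rfl hch h1 hlt h3 hu.1
      obtain ⟨h7, h8⟩ := hmem y hy h4 h5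
      have : y = x := Entry.ext h6 h7 h8
      rwa [← this]
    -- A one-point interval is never maximal, since it lies in a nondegenerate item.
    · obtain ⟨y, hy, h4⟩ := hc.exists_mem_Icc h1K ⟨h1, h2.trans h3⟩
      obtain ⟨h7, h8⟩ := hmem y hy h4.1 (heq ▸ h4.2)
      have := (hc.of_mem hy).2.1
      linarith

end Tiles

end Output

/-! ### Termination: each loop consumes its list, and reverse-delete shrinks its edge set. -/

section Termination

variable {V : Type*} [DecidableEq V] {N : STNetwork V}

/-- Every run that starts from `c` is finite. -/
def Terminates (N : STNetwork V) (c : Config V) : Prop := Acc (fun c' c => Step N c c') c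

theorem terminates_edges {t : ℝ} {bs ps : List (Finset (Sym2 V))} {ts : List ℝ}
    (h : ∀ s, Terminates N (.groups t bs ps ts s)) (fs : List (Sym2 V)) (s : State V) :
    Terminates N (.edges t fs bs ps ts s) := by
  induction fs generalizing s with
  | nil => exact ⟨_, fun c hc => by cases hc; exact h _⟩
  | cons f fs ih => exact ⟨_, fun c hc => by cases hc; exact ih _⟩

theorem terminates_groups {t : ℝ} {ps : List (Finset (Sym2 V))} {ts : List ℝ}
    (h : ∀ s, Terminates N (.points t ps ts s)) (bs : List (Finset (Sym2 V))) (s : State V) :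
    Terminates N (.groups t bs ps ts s) := by
  induction bs generalizing s with
  | nil => exact ⟨_, fun c hc => by cases hc; exact h _⟩
  | cons b bs ih =>
    refine ⟨_, fun c hc => ?_⟩
    cases hc
    case pruneGroup => exact ih _
    case sameOrder => exact ih _
    case swap => exact ih _
    case beginEdges => exact terminates_edges ih _ _

theorem terminates_points {t : ℝ} {ts : List ℝ} (h : ∀ s, Terminates N (.times ts s))
    (ps : List (Finset (Sym2 V))) (s : State V) : Terminates N (.points t ps ts s) := by
  induction ps generalizing s with
  | nil => exact ⟨_, fun c hc => by cases hc; exact h _⟩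
  | cons p ps ih =>
    refine ⟨_, fun c hc => ?_⟩
    cases hc
    case prunePoint => exact ih _
    case groupPoint => exact terminates_groups ih _ _

theorem terminates_times (ts : List ℝ) (s : State V) : Terminates N (.times ts s) := by
  induction ts generalizing s with
  | nil => exact ⟨_, fun c hc => by cases hc; exact ⟨_, fun c hc => by cases hc⟩⟩
  | cons t ts ih => exact ⟨_, fun c hc => by cases hc; exact terminates_points ih _ _⟩

theorem terminates_reverseDelete (R : Finset (Sym2 V)) : Terminates N (.reverseDelete R) := by
  induction R using Finset.strongInduction with
  | H R ih =>
    refine ⟨_, fun c hc => ?_⟩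
    cases hc with
    | delete hD hfR hfD hC hh =>
      exact ih _ (Finset.erase_ssubset (Finset.insert_subset hfR hD.1 (hC.2.2 hh.1)))
    | start => exact terminates_times _ _

end Termination

/-! ### Existence of decreasing orders and heaviest edges. -/

section Orders

variable {V : Type*} {N : STNetwork V}

theorem exists_isDecreasingOrder {lighter : Sym2 V → Sym2 V → Prop} {w : Sym2 V → ℝ}
    {b : Finset (Sym2 V)} (hw : Set.InjOn w b)
    (hl : ∀ e ∈ b, ∀ f ∈ b, w e < w f → lighter e f) :
    ∃ l, STNetwork.IsDecreasingOrder lighter b l := by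
  classical
  suffices ∀ c : Finset (Sym2 V), c ⊆ b → ∃ l, STNetwork.IsDecreasingOrder lighter c l from
    this b subset_rfl
  intro c
  induction c using Finset.induction_on_max_value w with
  | empty => exact fun _ => ⟨[], ⟨List.nodup_nil, by simp⟩, List.Pairwise.nil⟩
  | insert a c hac hmax ih =>
    intro hcb
    obtain ⟨l, ⟨hnd, hmem⟩, hp⟩ := ih ((Finset.subset_insert _ _).trans hcb)
    refine ⟨a :: l, ⟨List.nodup_cons.2 ⟨fun h => hac ((hmem a).1 h), hnd⟩, fun x => ?_⟩,
      List.Pairwise.cons (fun x hx => ?_) hp⟩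
    · simp [hmem]
    · have hxc := (hmem x).1 hx
      have hab := hcb (Finset.mem_insert_self a c)
      have hxb := hcb (Finset.mem_insert_of_mem hxc)
      exact hl x hxb a hab (lt_of_le_of_ne (hmax x hxc) fun h => hac (hw hxb hab h ▸ hxc))

theorem exists_enumerates {α : Type*} [Finite α] (P : α → Prop) : ∃ l, Enumerates l P :=
  ⟨(Set.toFinite {x | P x}).toFinset.toList, Finset.nodup_toList _, fun x => by simp⟩

namespace STNetwork.Gap

variable {a b s : ℝ} {C : Finset (Sym2 V)} {h : Sym2 V}

theorem le_of_isHeaviest (hg : N.Gap a b) (hs : s ∈ Set.Ioo a b)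
    (hC : (C : Set (Sym2 V)) ⊆ N.graph.edgeSet) (hh : N.IsHeaviest a C h) {g : Sym2 V}
    (hgC : g ∈ C) : N.weight g s ≤ N.weight h s := by
  by_cases hgh : g = h
  · rw [hgh]
  · exact ((hg.lighterAfter_iff hs (hC hgC) (hC hh.1)).1 (hh.2 g hgC hgh)).le

theorem exists_isHeaviest (hg : N.Gap a b) (hC : (C : Set (Sym2 V)) ⊆ N.graph.edgeSet)
    (hne : C.Nonempty) : ∃ h, N.IsHeaviest a C h := by
  obtain ⟨s, hs⟩ := hg.nonempty
  obtain ⟨h, hh, hmax⟩ := C.exists_max_image (fun e => N.weight e s) hne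
  refine ⟨h, hh, fun g hgC hgh => (hg.lighterAfter_iff hs (hC hgC) (hC hh)).2 ?_⟩
  exact lt_of_le_of_ne (hmax g hgC) fun heq => hgh (hg.injOn s hs (hC hgC) (hC hh) heq)

end STNetwork.Gap

end Orders

/-! ### Bi-connected components and intersection points. -/

namespace STNetwork

section Components

variable {V : Type*} {N : STNetwork V}

theorem exists_isBiconnectedComponent [Finite V] [DecidableEq V] {C : Finset (Sym2 V)}
    {e f : Sym2 V} (hC : N.IsCycle C) (he : e ∈ C) (hf : f ∈ C) :
    ∃ B, N.IsBiconnectedComponent B ∧ e ∈ B ∧ f ∈ B := by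
  obtain ⟨B, hB, hmax⟩ := (Set.toFinite {S : Finset (Sym2 V) | S.Nonempty ∧
    (S : Set (Sym2 V)) ⊆ N.graph.edgeSet ∧
    ∀ e ∈ S, ∀ f ∈ S, e ≠ f → ∃ C, N.IsCycle C ∧ e ∈ C ∧ f ∈ C}).exists_le_maximal
    (a := C) ⟨⟨e, he⟩, hC.subset_edgeSet, fun x hx y hy _ => ⟨C, hC, hx, hy⟩⟩
  exact ⟨B, hmax, hB he, hB hf⟩

/-- A bi-connected component with an edge that lies on a single cycle is this cycle. -/
theorem IsBiconnectedComponent.eq_cycle {B C : Finset (Sym2 V)} {e : Sym2 V}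
    (hB : N.IsBiconnectedComponent B) (heB : e ∈ B) (hC : N.IsCycle C) (heC : e ∈ C)
    (huniq : ∀ C', N.IsCycle C' → e ∈ C' → C' = C) : B = C := by
  refine hB.eq_of_le ⟨⟨e, heC⟩, hC.subset_edgeSet, fun x hx y hy _ => ⟨C, hC, hx, hy⟩⟩
    fun g hg => ?_
  by_cases hge : e = g
  · exact hge ▸ heC
  · obtain ⟨C', hC', he, hg⟩ := hB.prop.2.2 e heB g hg hge
    exact huniq C' hC' he ▸ hg

theorem IsIntersectionPoint.eq_of_mem {t : ℝ} {p q : Finset (Sym2 V)} {e f : Sym2 V}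
    (hp : N.IsIntersectionPoint t p) (hq : N.IsIntersectionPoint t q) (he : e ∈ p) (hf : f ∈ q)
    (hef : N.weight e t = N.weight f t) : p = q := by
  obtain ⟨-, y, hy⟩ := hp
  obtain ⟨-, z, hz⟩ := hq
  have : y = z := ((hy e).1 he).2.symm.trans (hef.trans ((hz f).1 hf).2)
  ext g
  rw [hy, hz, this]

theorem IsIntersectionPoint.mem_of_weight_eq {t : ℝ} {p : Finset (Sym2 V)} {e f : Sym2 V}
    (hp : N.IsIntersectionPoint t p) (he : e ∈ p) (hf : f ∈ N.graph.edgeSet)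
    (hef : N.weight f t = N.weight e t) : f ∈ p := by
  obtain ⟨-, y, hy⟩ := hp
  exact (hy f).2 ⟨hf, hef.trans ((hy e).1 he).2⟩

theorem IsIntersectionPoint.subset_edgeSet {t : ℝ} {p : Finset (Sym2 V)}
    (hp : N.IsIntersectionPoint t p) : (p : Set (Sym2 V)) ⊆ N.graph.edgeSet := by
  obtain ⟨-, y, hy⟩ := hp
  exact fun e he => ((hy e).1 he).1

theorem IsGroup.subset [DecidableEq V] {p b : Finset (Sym2 V)} (hb : N.IsGroup p b) : b ⊆ p := by
  obtain ⟨-, B, -, rfl⟩ := hb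
  exact Finset.inter_subset_left

end Components

end STNetwork

/-! ### Change of order at one time: inversions and exchanges. -/

section Moments

variable {V : Type*} {N : STNetwork V}

/-- The intersection time `t` is processed, `ts` are the later ones; the order of the weights
before and after `t` is that at `s₁` and at `s₂`. -/
structure Moment (N : STNetwork V) (t : ℝ) (ts : List ℝ) (s₁ s₂ : ℝ) : Prop where
  before : ∃ a, N.Gap a t ∧ s₁ ∈ Set.Ioo a t
  after : N.Gap t (ts.headD N.K)
  mem_after : s₂ ∈ Set.Ioo t (ts.headD N.K)
  sorted : ts.Pairwise (· < ·)
  mem_iff : ∀ x, x ∈ ts ↔ N.IsIntersectionTime x ∧ t < x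

variable {t s₁ s₂ : ℝ} {ts : List ℝ}

theorem Moment.weight_le_of_before (h : Moment N t ts s₁ s₂) {e f : Sym2 V}
    (he : e ∈ N.graph.edgeSet) (hf : f ∈ N.graph.edgeSet) (hle : N.weight e s₁ ≤ N.weight f s₁) :
    N.weight e t ≤ N.weight f t := by
  obtain ⟨a, ha, hs⟩ := h.before
  exact ha.weight_le hs ⟨ha.lt.le, le_rfl⟩ he hf hle

theorem Moment.weight_le_of_after (h : Moment N t ts s₁ s₂) {e f : Sym2 V}
    (he : e ∈ N.graph.edgeSet) (hf : f ∈ N.graph.edgeSet) (hle : N.weight e s₂ ≤ N.weight f s₂) :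
    N.weight e t ≤ N.weight f t :=
  h.after.weight_le h.mem_after ⟨le_rfl, h.after.lt.le⟩ he hf hle

theorem Moment.lighterBefore_iff (h : Moment N t ts s₁ s₂) {e f : Sym2 V}
    (he : e ∈ N.graph.edgeSet) (hf : f ∈ N.graph.edgeSet) :
    N.LighterBefore t e f ↔ N.weight e s₁ < N.weight f s₁ := by
  obtain ⟨a, ha, hs⟩ := h.before
  exact ha.lighterBefore_iff hs he hf

theorem Moment.lighterAfter_iff (h : Moment N t ts s₁ s₂) {e f : Sym2 V}
    (he : e ∈ N.graph.edgeSet) (hf : f ∈ N.graph.edgeSet) :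
    N.LighterAfter t e f ↔ N.weight e s₂ < N.weight f s₂ :=
  h.after.lighterAfter_iff h.mem_after he hf

theorem Moment.injOn_before (h : Moment N t ts s₁ s₂) :
    Set.InjOn (fun e => N.weight e s₁) N.graph.edgeSet := by
  obtain ⟨a, ha, hs⟩ := h.before
  exact ha.injOn s₁ hs

theorem Moment.injOn_after (h : Moment N t ts s₁ s₂) :
    Set.InjOn (fun e => N.weight e s₂) N.graph.edgeSet :=
  h.after.injOn s₂ h.mem_after

theorem Moment.exists_orders (h : Moment N t ts s₁ s₂) {b : Finset (Sym2 V)}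
    (hb : (b : Set (Sym2 V)) ⊆ N.graph.edgeSet) :
    (∃ l, STNetwork.IsDecreasingOrder (N.LighterBefore t) b l) ∧
      ∃ l, STNetwork.IsDecreasingOrder (N.LighterAfter t) b l :=
  ⟨exists_isDecreasingOrder (h.injOn_before.mono hb) fun _ he _ hf =>
      (h.lighterBefore_iff (hb he) (hb hf)).2,
    exists_isDecreasingOrder (h.injOn_after.mono hb) fun _ he _ hf =>
      (h.lighterAfter_iff (hb he) (hb hf)).2⟩

/-- At time `t` the tree edge `e` becomes heavier than the non-tree edge `f` on a common cycle. -/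
structure IsInversion (N : STNetwork V) (t s₁ s₂ : ℝ) (T : Finset (Sym2 V)) (e f : Sym2 V) :
    Prop where
  mem : e ∈ T
  notMem : f ∉ T
  weight_eq : N.weight e t = N.weight f t
  cycle : ∃ C, N.IsCycle C ∧ e ∈ C ∧ f ∈ C
  lt_before : N.weight e s₁ < N.weight f s₁
  lt_after : N.weight f s₂ < N.weight e s₂

theorem IsInversion.not_allTreeOrAllNonTree {T b : Finset (Sym2 V)} {e f : Sym2 V}
    (h : IsInversion N t s₁ s₂ T e f) (he : e ∈ b) (hf : f ∈ b) : ¬ AllTreeOrAllNonTree T b := by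
  rintro (h' | h')
  · exact h.notMem (h' f hf)
  · exact h' e he h.mem

theorem IsInversion.ne_orders (hM : Moment N t ts s₁ s₂) {T b : Finset (Sym2 V)} {e f : Sym2 V}
    (h : IsInversion N t s₁ s₂ T e f) (hb : (b : Set (Sym2 V)) ⊆ N.graph.edgeSet)
    (he : e ∈ b) (hf : f ∈ b) {si sj : List (Sym2 V)}
    (hi : STNetwork.IsDecreasingOrder (N.LighterBefore t) b si)
    (hj : STNetwork.IsDecreasingOrder (N.LighterAfter t) b sj) : si ≠ sj := by
  rintro rfl
  have hij := hi.2.and hj.2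
  have := List.Pairwise.forall_of_forall_of_flip
    (R := fun x y => x = y ∨ (N.LighterBefore t y x ∧ N.LighterAfter t y x) ∨
      (N.LighterBefore t x y ∧ N.LighterAfter t x y))
    (fun _ _ => Or.inl rfl) (hij.imp fun h => Or.inr (Or.inl h))
    (hij.imp fun h => Or.inr (Or.inr h)) ((hi.1.2 e).2 he) ((hi.1.2 f).2 hf)
  rcases this with rfl | h' | h'
  · exact h.notMem h.mem
  · exact h.lt_before.not_gt ((hM.lighterBefore_iff (hb hf) (hb he)).1 h'.1)
  · exact h.lt_after.not_gt ((hM.lighterAfter_iff (hb he) (hb hf)).1 h'.2)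

variable [DecidableEq V]

/-- The bypass of `f` that was light before `t` is either still light after `t`, or contains an edge
that overtook `f`. -/
theorem Moment.spansLight_or_isInversion [Fintype V] (hM : Moment N t ts s₁ s₂)
    {T : Finset (Sym2 V)} (hT : N.IsMST s₁ T) {f : Sym2 V} (hf : f ∈ N.graph.edgeSet) :
    SpansLight (fun e => N.weight e s₂) T f ∨ ∃ e, IsInversion N t s₁ s₂ T e f := by
  by_cases hfT : f ∈ T
  · exact Or.inl (connects_of_mem ⟨hfT, le_rfl⟩)
  obtain ⟨P, hPT, hPf, hP⟩ := STNetwork.exists_isCycle_of_connects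
    (fun e he => hT.1.1 he.1) hf (fun h => hfT h.1) ((STNetwork.isMST_iff.1 hT).2 f hf)
  by_cases hall : ∀ e ∈ P, N.weight e s₂ ≤ N.weight f s₂
  · exact Or.inl (hPf.mono fun e he => ⟨(hPT he).1, hall e he⟩)
  · push Not at hall
    obtain ⟨e, he, hlt⟩ := hall
    obtain ⟨heT, hle⟩ := hPT he
    have heE := hT.1.1 heT
    refine Or.inr ⟨e, heT, hfT, ?_, ⟨_, hP, Finset.mem_insert_of_mem he,
      Finset.mem_insert_self _ _⟩, lt_of_le_of_ne hle fun heq => ?_, hlt⟩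
    -- The orders before and after are opposite, and both persist weakly at `t`.
    · exact le_antisymm (hM.weight_le_of_before heE hf hle) (hM.weight_le_of_after hf heE hlt.le)
    · exact hfT (hM.injOn_before heE hf heq ▸ heT)

/-- As the heaviest edge after `t`, `h` weighs at least as much as `f` at `t`; minimality of `T` at
`t` gives the reverse inequality. The criterion at `s₂` survives because `h` is heaviest on a cycle.
-/
theorem Moment.exchange [Fintype V] (hM : Moment N t ts s₁ s₂) {T C : Finset (Sym2 V)}
    {f h : Sym2 V} (hT : N.IsMST t T) (hfT : f ∉ T) (hC : N.IsFundamentalCycle T f C)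
    (hh : N.IsHeaviest t C h) :
    N.weight h t = N.weight f t ∧ N.IsMST t ((insert f T).erase h) ∧
      ∀ g, SpansLight (fun e => N.weight e s₂) T g ∨ g = f →
        SpansLight (fun e => N.weight e s₂) ((insert f T).erase h : Finset (Sym2 V)) g := by
  have hCE := hC.1.subset_edgeSet
  have hmax : ∀ g ∈ C, N.weight g s₂ ≤ N.weight h s₂ := fun g hg =>
    hM.after.le_of_isHeaviest hM.mem_after hCE hh hg
  obtain ⟨h1, h2⟩ := hT.exchange hfT hC hh.1
    (hM.weight_le_of_after (hCE hC.2.1) (hCE hh.1) (hmax f hC.2.1))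
  refine ⟨h1, h2, fun g hg => ?_⟩
  rw [Finset.coe_erase]
  refine SpansLight.erase ?_ hC.1 (Finset.coe_subset.2 hC.2.2) hh.1 hmax
  rcases hg with hg | rfl
  · exact Connects.mono hg fun e he => ⟨Finset.mem_insert_of_mem he.1, he.2⟩
  · exact connects_of_mem ⟨Finset.mem_insert_self _ _, le_rfl⟩

/-- Two edges on a single cycle: if their order changes, then the lighter one replaces the heavier
one as the heaviest edge of its fundamental cycle. -/
theorem Moment.swap [Fintype V] (hM : Moment N t ts s₁ s₂) {T T' p b : Finset (Sym2 V)}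
    {h l : Sym2 V} (hT : N.IsMST s₁ T) (hT' : N.IsMST t T') (hp : N.IsIntersectionPoint t p)
    (hb : N.IsGroup p b) (hbhl : ∀ x, x ∈ b ↔ x = h ∨ x = l)
    (hon : N.OnOnlyTheCommonCycle h l) (hbef : N.weight h s₁ < N.weight l s₁)
    (haft : N.weight l s₂ < N.weight h s₂) (hnot : ¬ AllTreeOrAllNonTree T b)
    (hh : h ∈ T' ↔ h ∈ T) (hl : l ∈ T' ↔ l ∈ T) :
    h ∈ T' ∧ l ∉ T' ∧ ∃ C, N.IsFundamentalCycle T' l C ∧ N.IsHeaviest t C h := by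
  obtain ⟨D, ⟨hD, hhD, hlD⟩, huniq⟩ := hon
  have hDE := hD.subset_edgeSet
  have hne : l ≠ h := by rintro rfl; exact hbef.false
  have hcase : h ∈ T ∧ l ∉ T := by
    by_cases hhT : h ∈ T
    · refine ⟨hhT, fun hlT => hnot (Or.inl fun x hx => ?_)⟩
      rcases (hbhl x).1 hx with rfl | rfl <;> assumption
    · exfalso
      by_cases hlT : l ∈ T
      -- The light bypass of `h` before `t` closes the only cycle through `h`, so it contains `l`;
      -- but `l` was heavier than `h`.
      · obtain ⟨P, hPT, -, hP⟩ := STNetwork.exists_isCycle_of_connects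
          (fun e he => hT.1.1 he.1) (hDE hhD) (fun h => hhT h.1)
          ((STNetwork.isMST_iff.1 hT).2 h (hDE hhD))
        have hPD := huniq _ hP (Or.inl (Finset.mem_insert_self _ _))
        rw [← hPD] at hlD
        exact hbef.not_ge (hPT ((Finset.mem_insert.1 hlD).resolve_left hne)).2
      · refine hnot (Or.inr fun x hx => ?_)
        rcases (hbhl x).1 hx with rfl | rfl <;> assumption
  rw [← hh, ← hl] at hcase
  refine ⟨hcase.1, hcase.2, ?_⟩
  obtain ⟨C, hC⟩ := hT'.1.exists_isFundamentalCycle (hDE hlD) hcase.2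
  have hCD := huniq C hC.1 (Or.inr hC.2.1)
  subst hCD
  -- The heaviest edge `g` of the cycle has the weight of `l` at `t`, and the component is this
  -- cycle. So `g` belongs to the group, and it is not the lighter edge `l`.
  obtain ⟨g, hg⟩ := hM.after.exists_isHeaviest hDE ⟨h, hhD⟩
  have hgl := (hM.exchange hT' hcase.2 hC hg).1
  obtain ⟨-, B, hB, rfl⟩ := hb
  have hlb := (hbhl l).2 (Or.inr rfl)
  have hBC := hB.eq_cycle (Finset.mem_inter.1 hlb).2 hD hlD fun C' hC' h => huniq C' hC' (Or.inr h)
  have hgp := hp.mem_of_weight_eq (Finset.mem_inter.1 hlb).1 (hDE hg.1) hgl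
  refine ⟨C, hC, ?_⟩
  rcases (hbhl g).1 (Finset.mem_inter.2 ⟨hgp, hBC ▸ hg.1⟩) with rfl | rfl
  · exact hg
  · exact absurd ((hM.lighterAfter_iff (hDE hhD) (hDE hlD)).1 (hg.2 h hhD hne.symm)) haft.not_gt

end Moments

/-! ### Loop invariants and their preservation under exchange. -/

section Invariants

variable {V : Type*} {N : STNetwork V}

/-- The tree that the updates at the current time start from. -/
def State.tree (s : State V) : Finset (Sym2 V) := if s.newExists then s.cur else s.prev

theorem State.beginUpdate_cur (s : State V) : s.beginUpdate.cur = s.tree := rfl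

/-- The intersection points `ps` are still unvisited, and `T` agrees with `T₀` there. -/
structure PointsInv (N : STNetwork V) (t : ℝ) (ps : List (Finset (Sym2 V)))
    (T₀ T : Finset (Sym2 V)) : Prop where
  nodup : ps.Nodup
  isPoint : ∀ p ∈ ps, N.IsIntersectionPoint t p
  agree : ∀ p ∈ ps, ∀ e ∈ p, e ∈ T ↔ e ∈ T₀

/-- The groups `bs` of the point `p` are still unvisited, and `T` agrees with `T₀` on those of
them that consist of two edges on a single cycle. -/
structure GroupsInv [DecidableEq V] (N : STNetwork V) (p : Finset (Sym2 V))
    (bs : List (Finset (Sym2 V))) (T₀ T : Finset (Sym2 V)) : Prop where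
  nodup : bs.Nodup
  isGroup : ∀ b ∈ bs, N.IsGroup p b
  agree : ∀ b ∈ bs, ∀ h l, (∀ x, x ∈ b ↔ x = h ∨ x = l) → N.OnOnlyTheCommonCycle h l →
    ∀ e ∈ b, e ∈ T ↔ e ∈ T₀

/-- Some member of `L` contains an inversion with the non-tree edge `f`. -/
def Pending (N : STNetwork V) (t s₁ s₂ : ℝ) (T : Finset (Sym2 V)) (L : List (Finset (Sym2 V)))
    (f : Sym2 V) : Prop :=
  ∃ p ∈ L, ∃ e ∈ p, f ∈ p ∧ IsInversion N t s₁ s₂ T e f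

/-- The invariant of the loop over the intersection points at time `t`: every edge is either
joined by lighter edges of the current tree, or is waiting to be inserted. -/
structure LoopInv (N : STNetwork V) (t s₁ s₂ : ℝ) (ts : List ℝ) (s : State V)
    (P : Sym2 V → Prop) : Prop where
  moment : Moment N t ts s₁ s₂
  changed : s.changed = s.newExists
  tiles : Tiles N s.start 1 s.out
  start_lt : s.start < t
  isMST_Icc : ∀ x ∈ Set.Icc s.start t, N.IsMST x s.prev
  isMST_before : N.IsMST s₁ s.prev
  isMST : N.IsMST t s.tree
  light : ∀ f ∈ N.graph.edgeSet, SpansLight (fun e => N.weight e s₂) s.tree f ∨ P f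

/-- The invariant of the loop over the intersection times. -/
structure TimesInv (N : STNetwork V) (ts : List ℝ) (s : State V) : Prop where
  tiles : Tiles N s.start 1 s.out
  exists_gap : ∃ a, s.start ≤ a ∧ N.Gap a (ts.headD N.K) ∧
    (∀ x ∈ Set.Icc s.start (ts.headD N.K), N.IsMST x s.prev) ∧
    ts.Pairwise (· < ·) ∧ ∀ x, x ∈ ts ↔ N.IsIntersectionTime x ∧ a < x

variable {t s₁ s₂ : ℝ} {ts : List ℝ} {s : State V}

theorem LoopInv.mono {P Q : Sym2 V → Prop} (h : LoopInv N t s₁ s₂ ts s P) (hPQ : ∀ f, P f → Q f) :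
    LoopInv N t s₁ s₂ ts s Q :=
  ⟨h.moment, h.changed, h.tiles, h.start_lt, h.isMST_Icc, h.isMST_before, h.isMST,
    fun f hf => (h.light f hf).imp_right (hPQ f)⟩

theorem PointsInv.tail {p : Finset (Sym2 V)} {ps : List (Finset (Sym2 V))} {T₀ T : Finset (Sym2 V)} (h : PointsInv N t (p :: ps) T₀ T) :
    PointsInv N t ps T₀ T :=
  ⟨h.nodup.of_cons, fun q hq => h.isPoint q (List.mem_cons_of_mem _ hq),
    fun q hq => h.agree q (List.mem_cons_of_mem _ hq)⟩

theorem gap_headD [Finite V] {ts : List ℝ} {a : ℝ} (ha : 1 ≤ a) (haK : a < N.K) (hs : ts.Pairwise (· < ·))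
    (hmem : ∀ x, x ∈ ts ↔ N.IsIntersectionTime x ∧ a < x) : N.Gap a (ts.headD N.K) := by
  cases ts with
  | nil =>
    refine .of_forall_notMem_isIntersectionTime ha haK le_rfl fun t ht hint => ?_
    exact absurd ((hmem t).2 ⟨hint, ht.1⟩) List.not_mem_nil
  | cons t' ts =>
    obtain ⟨h1, h2⟩ := (hmem t').1 List.mem_cons_self
    refine .of_forall_notMem_isIntersectionTime ha h2 h1.2.1.le fun t ht hint => ?_
    rcases List.mem_cons.1 ((hmem t).2 ⟨hint, ht.1⟩) with rfl | h3
    · exact ht.2.false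
    · exact ht.2.not_gt (List.rel_of_pairwise_cons hs h3)

variable [DecidableEq V]

/-- The invariant of the loop over the groups of one intersection point. -/
structure GroupLoopInv (N : STNetwork V) (t s₁ s₂ : ℝ) (p : Finset (Sym2 V))
    (bs ps : List (Finset (Sym2 V))) (ts : List ℝ) (s : State V) (P : Sym2 V → Prop) : Prop where
  loop : LoopInv N t s₁ s₂ ts s fun f =>
    Pending N t s₁ s₂ s.prev ps f ∨ Pending N t s₁ s₂ s.prev bs f ∨ P f
  points : PointsInv N t ps s.prev s.tree
  isPoint : N.IsIntersectionPoint t p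
  notMem : p ∉ ps
  groups : GroupsInv N p bs s.prev s.tree

/-- What holds at the program points of the algorithm. -/
def Invariant (N : STNetwork V) : Config V → Prop
  | .reverseDelete R => (R : Set (Sym2 V)) ⊆ N.graph.edgeSet ∧ ∃ c, N.Gap 1 c ∧
      ∃ x ∈ Set.Ioo 1 c, ∀ f ∈ N.graph.edgeSet, SpansLight (fun e => N.weight e x) R f
  | .times ts s => TimesInv N ts s
  | .points t ps ts s => ∃ s₁ s₂, LoopInv N t s₁ s₂ ts s (Pending N t s₁ s₂ s.prev ps) ∧
      PointsInv N t ps s.prev s.tree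
  | .groups t bs ps ts s => ∃ s₁ s₂ p, GroupLoopInv N t s₁ s₂ p bs ps ts s fun _ => False
  | .edges t fs bs ps ts s => ∃ s₁ s₂ p b, (GroupLoopInv N t s₁ s₂ p bs ps ts s fun f => f ∈ fs) ∧
      s.newExists = true ∧ N.IsGroup p b ∧ b ∉ bs ∧ fs.Nodup ∧ ∀ f ∈ fs, f ∈ b ∧ f ∉ s.cur
  | .halted out => IsCorrectOutput N out

variable {p b : Finset (Sym2 V)}
  {bs ps : List (Finset (Sym2 V))} {P Q : Sym2 V → Prop}

theorem GroupsInv.tail {T₀ T : Finset (Sym2 V)} (h : GroupsInv N p (b :: bs) T₀ T) :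
    GroupsInv N p bs T₀ T :=
  ⟨h.nodup.of_cons, fun q hq => h.isGroup q (List.mem_cons_of_mem _ hq),
    fun q hq => h.agree q (List.mem_cons_of_mem _ hq)⟩

theorem mem_exchange_iff {T : Finset (Sym2 V)} {e f h : Sym2 V} (hf : e ≠ f) (hh : e ≠ h) :
    e ∈ (insert f T).erase h ↔ e ∈ T := by
  simp [hf, hh]

/-- Both exchanged edges belong to `p`, and distinct intersection points at the same time share no
edge. -/
theorem PointsInv.exchange {T₀ T : Finset (Sym2 V)} (H : PointsInv N t ps T₀ T)
    (hp : N.IsIntersectionPoint t p) (hpps : p ∉ ps) {f h : Sym2 V} (hf : f ∈ p) (hh : h ∈ p) :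
    PointsInv N t ps T₀ ((insert f T).erase h) := by
  refine ⟨H.nodup, H.isPoint, fun q hq e he => ?_⟩
  have hne : ∀ x ∈ p, e ≠ x := by
    rintro x hx rfl
    exact hpps (hp.eq_of_mem (H.isPoint q hq) hx he rfl ▸ hq)
  rw [mem_exchange_iff (hne f hf) (hne h hh)]
  exact H.agree q hq e he

/-- If the exchange cycle met a later group of two edges on a single cycle, it would be that cycle,
and hence the component of both groups. The groups would coincide. -/
theorem GroupsInv.exchange {T₀ T C : Finset (Sym2 V)} (H : GroupsInv N p bs T₀ T)
    (hb : N.IsGroup p b) (hbbs : b ∉ bs) {f h : Sym2 V} (hf : f ∈ b) (hC : N.IsCycle C)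
    (hfC : f ∈ C) (hhC : h ∈ C) : GroupsInv N p bs T₀ ((insert f T).erase h) := by
  refine ⟨H.nodup, H.isGroup, fun q hq h' l' hqhl hon e he => ?_⟩
  have hne : ∀ x ∈ C, e ≠ x := by
    rintro x hx rfl
    obtain ⟨D, ⟨hD, hhD, hlD⟩, huniq⟩ := id hon
    have huniq' : ∀ y ∈ q, ∀ C', N.IsCycle C' → y ∈ C' → C' = D := by
      intro y hy C' hC' hyC'
      rcases (hqhl y).1 hy with rfl | rfl
      · exact huniq C' hC' (Or.inl hyC')
      · exact huniq C' hC' (Or.inr hyC')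
    have hCD := huniq' e he C hC hx
    subst hCD
    obtain ⟨-, B, hB, rfl⟩ := hb
    obtain ⟨-, B', hB', rfl⟩ := H.isGroup q hq
    have h1 := hB'.eq_cycle (Finset.mem_inter.1 he).2 hC hx (huniq' e he)
    have hfB := Finset.mem_inter.1 hf
    have hfq : f ∈ p ∩ B' := Finset.mem_inter.2 ⟨hfB.1, h1 ▸ hfC⟩
    have h2 := hB.eq_cycle hfB.2 hC hfC (huniq' f hfq)
    exact hbbs (by rw [h2, ← h1]; exact hq)
  rw [mem_exchange_iff (hne f hfC) (hne h hhC)]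
  exact H.agree q hq h' l' hqhl hon e he

variable [Fintype V]

/-- The invariant is kept when the edge `f` of the group `b` is inserted into the tree and the
heaviest edge `h` of its cycle is deleted. -/
theorem GroupLoopInv.exchange (H : GroupLoopInv N t s₁ s₂ p bs ps ts s P) (hb : N.IsGroup p b)
    (hbbs : b ∉ bs) {f h : Sym2 V} {C : Finset (Sym2 V)} (hfb : f ∈ b) (hfT : f ∉ s.tree)
    (hC : N.IsFundamentalCycle s.tree f C) (hh : N.IsHeaviest t C h)
    (hPQ : ∀ g, P g → g = f ∨ Q g) :
    GroupLoopInv N t s₁ s₂ p bs ps ts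
      { s.beginUpdate with cur := (insert f s.tree).erase h } Q := by
  obtain ⟨h1, h2, h3⟩ := H.loop.moment.exchange H.loop.isMST hfT hC hh
  have hfp := hb.subset hfb
  have hhp := H.isPoint.mem_of_weight_eq hfp (hC.1.subset_edgeSet hh.1) h1
  refine ⟨⟨H.loop.moment, rfl, H.loop.tiles, H.loop.start_lt, H.loop.isMST_Icc,
    H.loop.isMST_before, h2, fun g hg => ?_⟩, H.points.exchange H.isPoint H.notMem hfp hhp,
    H.isPoint, H.notMem, H.groups.exchange hb hbbs hfb hC.1 hC.2.1 hh.1⟩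
  by_cases hgf : g = f
  · exact Or.inl (h3 g (Or.inr hgf))
  · rcases H.loop.light g hg with h4 | h4 | h4 | h4
    · exact Or.inl (h3 g (Or.inl h4))
    · exact Or.inr (Or.inl h4)
    · exact Or.inr (Or.inr (Or.inl h4))
    · exact Or.inr (Or.inr (Or.inr ((hPQ g h4).resolve_left hgf)))

/-- Every edge violating the criterion at `s₂` is part of an inversion; its two edges share a weight
at `t`, so one of the enumerated points contains both. -/
theorem TimesInv.loopInv {t : ℝ} (h : TimesInv N (t :: ts) s)
    (hps : Enumerates ps (N.IsIntersectionPoint t)) :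
    Invariant N (.points t ps ts { s with changed := false, newExists := false }) := by
  obtain ⟨htiles, a, hsa, hgap, hM, hs, hmem⟩ := h
  simp only [List.headD_cons] at hgap hM
  obtain ⟨ht, -⟩ := (hmem t).1 List.mem_cons_self
  have hmem' : ∀ x, x ∈ ts ↔ N.IsIntersectionTime x ∧ t < x := by
    intro x
    constructor
    · intro hx
      exact ⟨((hmem x).1 (List.mem_cons_of_mem _ hx)).1, List.rel_of_pairwise_cons hs hx⟩
    · rintro ⟨hx, htx⟩
      exact (List.mem_cons.1 ((hmem x).2 ⟨hx, hgap.lt.trans htx⟩)).resolve_left htx.ne'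
  have hgap' := gap_headD ht.1.le ht.2.1 hs.of_cons hmem'
  obtain ⟨s₁, hs₁⟩ := hgap.nonempty
  obtain ⟨s₂, hs₂⟩ := hgap'.nonempty
  have hmom : Moment N t ts s₁ s₂ := ⟨⟨a, hgap, hs₁⟩, hgap', hs₂, hs.of_cons, hmem'⟩
  have hM₁ := hM s₁ ⟨hsa.trans hs₁.1.le, hs₁.2.le⟩
  refine ⟨s₁, s₂, ⟨hmom, rfl, htiles, hsa.trans_lt hgap.lt, hM, hM₁,
    hM t ⟨hsa.trans hgap.lt.le, le_rfl⟩, fun f hf => ?_⟩,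
    ⟨hps.1, fun p hp => (hps.2 p).1 hp, fun _ _ _ _ => Iff.rfl⟩⟩
  refine (hmom.spansLight_or_isInversion hM₁ hf).imp_right fun ⟨e, he⟩ => ?_
  obtain ⟨C, hC, heC, hfC⟩ := he.cycle
  have hne : e ≠ f := by rintro rfl; exact he.notMem he.mem
  have heE := hC.subset_edgeSet heC
  obtain ⟨p, hp⟩ : ∃ p : Finset (Sym2 V),
      ∀ g, g ∈ p ↔ g ∈ N.graph.edgeSet ∧ N.weight g t = N.weight f t :=
    ⟨(Set.toFinite {g | g ∈ N.graph.edgeSet ∧ N.weight g t = N.weight f t}).toFinset,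
      fun g => by simp⟩
  have hep := (hp e).2 ⟨heE, he.weight_eq⟩
  have hfp := (hp f).2 ⟨hf, rfl⟩
  exact ⟨p, (hps.2 p).2 ⟨Finset.one_lt_card.2 ⟨e, hep, f, hfp, hne⟩, _, hp⟩, e, hep, hfp, he⟩

theorem LoopInv.timesInv (h : LoopInv N t s₁ s₂ ts s fun _ => False) :
    TimesInv N ts (s.report t) := by
  have hM : N.IsMST s₂ s.tree := STNetwork.isMST_iff.2
    ⟨h.isMST.1, fun f hf => (h.light f hf).resolve_right id⟩
  have hgap := h.moment.after
  have hM' : ∀ x ∈ Set.Icc t (ts.headD N.K), N.IsMST x s.tree :=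
    fun x hx => hgap.isMST h.moment.mem_after hM hx
  have hrest := And.intro h.moment.sorted h.moment.mem_iff
  rw [State.report]
  have hc := h.changed
  rw [State.tree] at hM'
  split_ifs with hch
  · rw [if_pos (hc ▸ hch)] at hM'
    exact ⟨h.tiles.concat (x := ⟨s.prev, s.start, t⟩) rfl h.start_lt h.isMST_Icc, t, le_rfl, hgap, hM', hrest⟩
  -- Without a change the current tree is the previous one, so its open interval simply extends past
  -- `t`.
  · rw [if_neg (hc ▸ hch)] at hM'
    refine ⟨h.tiles, t, h.start_lt.le, hgap, fun x hx => ?_, hrest⟩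
    rcases le_total x t with hxt | hxt
    · exact h.isMST_Icc x ⟨hx.1, hxt⟩
    · exact hM' x ⟨hxt, hx.2⟩

end Invariants

/-! ### Preservation of the invariant along runs, and progress. -/

section Runs

variable {V : Type*} {N : STNetwork V}

theorem Pending.of_cons {t s₁ s₂ : ℝ} {T p : Finset (Sym2 V)} {L : List (Finset (Sym2 V))}
    {f : Sym2 V} (h : Pending N t s₁ s₂ T (p :: L) f) :
    (∃ e ∈ p, f ∈ p ∧ IsInversion N t s₁ s₂ T e f) ∨ Pending N t s₁ s₂ T L f := by
  obtain ⟨q, hq, hqf⟩ := h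
  rcases List.mem_cons.1 hq with rfl | hq
  · exact Or.inl hqf
  · exact Or.inr ⟨q, hq, hqf⟩

theorem mem_iff_of_enumerates_pair {b : Finset (Sym2 V)} {h l : Sym2 V}
    (hb : Enumerates [h, l] (· ∈ b)) (x : Sym2 V) : x ∈ b ↔ x = h ∨ x = l := by
  simpa using (hb.2 x).symm

/-- If the order of two edges changes, then the heavier one after `t` was the lighter one
before. -/
theorem Moment.lt_before_of_ne {t s₁ s₂ : ℝ} {ts : List ℝ} (hM : Moment N t ts s₁ s₂)
    {b : Finset (Sym2 V)} (hb : (b : Set (Sym2 V)) ⊆ N.graph.edgeSet) {si : List (Sym2 V)}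
    {h l : Sym2 V} (hi : STNetwork.IsDecreasingOrder (N.LighterBefore t) b si)
    (hj : Enumerates [h, l] (· ∈ b)) (hne : si ≠ [h, l]) : N.weight h s₁ < N.weight l s₁ := by
  have hmem := mem_iff_of_enumerates_pair hj
  have hperm : si.Perm [h, l] :=
    (List.perm_ext_iff_of_nodup hi.1.1 hj.1).2 fun x => (hi.1.2 x).trans (hj.2 x).symm
  rcases List.perm_pair.1 hperm with rfl | rfl
  · exact absurd rfl hne
  · refine (hM.lighterBefore_iff (hb ((hmem h).2 (Or.inl rfl))) (hb ((hmem l).2 (Or.inr rfl)))).1 ?_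
    exact List.rel_of_pairwise_cons hi.2 (by simp)

variable [DecidableEq V]

/-- When a group leaves the list, only its inverted edges outside the current tree need a new
justification `P`; an edge inside the tree is its own bypass. -/
theorem GroupLoopInv.skip {t s₁ s₂ : ℝ} {ts : List ℝ} {s : State V} {p b : Finset (Sym2 V)}
    {bs ps : List (Finset (Sym2 V))} {P : Sym2 V → Prop}
    (H : GroupLoopInv N t s₁ s₂ p (b :: bs) ps ts s fun _ => False)
    (hb : ∀ e ∈ b, ∀ f ∈ b, IsInversion N t s₁ s₂ s.prev e f → f ∉ s.tree → P f) :
    GroupLoopInv N t s₁ s₂ p bs ps ts s P := by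
  refine ⟨{ H.loop with light := fun f hf => ?_ }, H.points, H.isPoint, H.notMem, H.groups.tail⟩
  by_cases hfT : f ∈ s.tree
  · exact Or.inl (connects_of_mem ⟨hfT, le_rfl⟩)
  refine (H.loop.light f hf).imp_right (Or.imp_right fun h => ?_)
  rcases (h.resolve_right id).of_cons with ⟨e, he, hfb, hef⟩ | h
  · exact Or.inr (hb e he f hfb hef hfT)
  · exact Or.inl h

theorem GroupLoopInv.beginUpdate {t s₁ s₂ : ℝ} {ts : List ℝ} {s : State V} {p : Finset (Sym2 V)}
    {bs ps : List (Finset (Sym2 V))} {P : Sym2 V → Prop}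
    (H : GroupLoopInv N t s₁ s₂ p bs ps ts s P) :
    GroupLoopInv N t s₁ s₂ p bs ps ts s.beginUpdate P :=
  ⟨⟨H.loop.moment, rfl, H.loop.tiles, H.loop.start_lt, H.loop.isMST_Icc, H.loop.isMST_before,
    H.loop.isMST, H.loop.light⟩, H.points, H.isPoint, H.notMem, H.groups⟩

variable [Fintype V]

theorem IsInversion.not_inDifferentComponents {t s₁ s₂ : ℝ} {T p : Finset (Sym2 V)} {e f : Sym2 V}
    (h : IsInversion N t s₁ s₂ T e f) (he : e ∈ p) (hf : f ∈ p) :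
    ¬ N.InDifferentComponents p := by
  obtain ⟨C, hC, heC, hfC⟩ := h.cycle
  exact fun hp => hp e he f hf (fun hef => h.notMem (hef ▸ h.mem))
    (STNetwork.exists_isBiconnectedComponent hC heC hfC)

theorem IsInversion.exists_isGroup {t s₁ s₂ : ℝ} {T p : Finset (Sym2 V)} {e f : Sym2 V}
    (h : IsInversion N t s₁ s₂ T e f) (he : e ∈ p) (hf : f ∈ p) :
    ∃ b, N.IsGroup p b ∧ e ∈ b ∧ f ∈ b := by
  obtain ⟨C, hC, heC, hfC⟩ := h.cycle
  obtain ⟨B, hB, heB, hfB⟩ := STNetwork.exists_isBiconnectedComponent hC heC hfC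
  have heb := Finset.mem_inter.2 ⟨he, heB⟩
  exact ⟨p ∩ B, ⟨⟨e, heb⟩, B, hB, rfl⟩, heb, Finset.mem_inter.2 ⟨hf, hfB⟩⟩

/-- Every step of the algorithm keeps the invariant. -/
theorem Step.invariant {c c' : Config V} (h : Step N c c') (hc : Invariant N c) :
    Invariant N c' := by
  cases h with
  | @delete R D C f h hD hfR hfD hC hh =>
    obtain ⟨hR, u, hgap, x, hx, hl⟩ := hc
    refine ⟨fun e he => hR (Finset.mem_of_mem_erase he), u, hgap, x, hx, fun g hg => ?_⟩
    rw [Finset.coe_erase]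
    exact (hl g hg).erase hC.1 (Finset.coe_subset.2
      (hC.2.2.trans (Finset.insert_subset hfR hD.1))) hh.1
      fun e he => hgap.le_of_isHeaviest hx hC.1.subset_edgeSet hh he
  | @start R D ts hD hRD hts hs =>
    obtain ⟨hR, u, hgap, x, hx, hl⟩ := hc
    obtain rfl := hRD.antisymm hD.1
    have hMx : N.IsMST x R := STNetwork.isMST_iff.2 ⟨hD.2.1, hl⟩
    have hmem : ∀ y, y ∈ ts ↔ N.IsIntersectionTime y ∧ 1 < y :=
      fun y => (hts.2 y).trans ⟨fun h => ⟨h, h.1⟩, fun h => h.1⟩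
    have hgap' := gap_headD le_rfl N.one_lt_K hs hmem
    -- The gap used during reverse-delete need not end at the first intersection time; a time in
    -- both gaps transfers minimality.
    obtain ⟨y, hy1, hy2⟩ := exists_between (lt_min hgap.lt hgap'.lt)
    have hMy := hgap.isMST hx hMx ⟨hy1.le, (hy2.trans_le (min_le_left _ _)).le⟩
    exact ⟨rfl, 1, le_rfl, hgap', fun z hz =>
      hgap'.isMST ⟨hy1, hy2.trans_le (min_le_right _ _)⟩ hMy hz, hs, hmem⟩
  | beginTime hps => exact TimesInv.loopInv hc hps
  | prunePoint hpr =>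
    obtain ⟨s₁, s₂, H, Hp⟩ := hc
    refine ⟨s₁, s₂, H.mono fun f hf => hf.of_cons.resolve_left ?_, Hp.tail⟩
    rintro ⟨e, he, hf, hef⟩
    exact hpr.elim (hef.not_allTreeOrAllNonTree he hf) (hef.not_inDifferentComponents he hf)
  | @groupPoint t p bs ps ts s hpr hbs =>
    obtain ⟨s₁, s₂, H, Hp⟩ := hc
    refine ⟨s₁, s₂, p, H.mono fun f hf => ?_, Hp.tail, Hp.isPoint p List.mem_cons_self,
      (List.nodup_cons.1 Hp.nodup).1, hbs.1, fun b hb => (hbs.2 b).1 hb,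
      fun b hb h l _ _ e he => Hp.agree p List.mem_cons_self e (((hbs.2 b).1 hb).subset he)⟩
    rcases hf.of_cons with ⟨e, he, hfp, hef⟩ | hf
    · obtain ⟨b, hb, heb, hfb⟩ := hef.exists_isGroup he hfp
      exact Or.inr (Or.inl ⟨b, (hbs.2 b).2 hb, e, heb, hfb, hef⟩)
    · exact Or.inl hf
  | pruneGroup hb =>
    obtain ⟨s₁, s₂, p, H⟩ := hc
    exact ⟨s₁, s₂, p, H.skip fun e he f hf hef _ => hef.not_allTreeOrAllNonTree he hf hb⟩
  | sameOrder _ hi hj hij =>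
    obtain ⟨s₁, s₂, p, H⟩ := hc
    refine ⟨s₁, s₂, p, H.skip fun e he f hf hef _ => ?_⟩
    exact hef.ne_orders H.loop.moment (fun x hx => H.isPoint.subset_edgeSet
      ((H.groups.isGroup _ List.mem_cons_self).subset hx)) he hf hi hj hij
  | @swap t b bs ps ts si sj h l s hnot hi hj hij hsj hon =>
    subst hsj
    obtain ⟨s₁, s₂, p, H⟩ := hc
    have hM := H.loop.moment
    have hbg := H.groups.isGroup b List.mem_cons_self
    have hbE : (b : Set (Sym2 V)) ⊆ N.graph.edgeSet :=
      fun x hx => H.isPoint.subset_edgeSet (hbg.subset hx)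
    have hmem := mem_iff_of_enumerates_pair hj.1
    have hhb := (hmem h).2 (Or.inl rfl)
    have hlb := (hmem l).2 (Or.inr rfl)
    have hbef := hM.lt_before_of_ne hbE hi hj.1 hij
    have haft := (hM.lighterAfter_iff (hbE hlb) (hbE hhb)).1
      (List.rel_of_pairwise_cons hj.2 (List.mem_singleton_self l))
    have hagree := H.groups.agree b List.mem_cons_self h l hmem hon
    obtain ⟨hhT, hlT, C, hC, hh⟩ := hM.swap H.loop.isMST_before H.loop.isMST H.isPoint hbg hmem hon
      hbef haft hnot (hagree h hhb) (hagree l hlb)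
    have hbbs := (List.nodup_cons.1 H.groups.nodup).1
    -- Since `h` and `l` differ, deleting first or inserting first is the same, and the shortcut
    -- becomes an exchange.
    rw [State.beginUpdate_cur, ← Finset.erase_insert_of_ne (by rintro rfl; exact hlT hhT)]
    have H' : GroupLoopInv N t s₁ s₂ p bs ps ts s fun f => f ∈ b ∧ f ∉ s.tree :=
      H.skip fun _ _ f hf _ hfT => ⟨hf, hfT⟩
    refine ⟨s₁, s₂, p, H'.exchange hbg hbbs hlb hlT hC hh fun g hg => Or.inl ?_⟩
    refine ((hmem g).1 hg.1).resolve_left ?_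
    rintro rfl
    exact hg.2 hhT
  | @beginEdges t b bs ps ts si sj s hnot hi hj hij hno =>
    obtain ⟨s₁, s₂, p, H⟩ := hc
    have hbg := H.groups.isGroup b List.mem_cons_self
    have hmem : ∀ f, f ∈ sj.filter (fun f => f ∉ s.beginUpdate.cur) ↔ f ∈ b ∧ f ∉ s.tree := by
      intro f
      rw [List.mem_filter, hj.1.2, State.beginUpdate_cur]
      simp
    refine ⟨s₁, s₂, p, b, (H.skip fun _ _ f hf _ hfT => (hmem f).2 ⟨hf, hfT⟩).beginUpdate, rfl,
      hbg, (List.nodup_cons.1 H.groups.nodup).1,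
      hj.1.1.filter _, fun f hf => (hmem f).1 hf⟩
  | @addEdge t f h C fs bs ps ts s hC hh =>
    obtain ⟨s₁, s₂, p, b, H, hnew, hbg, hbbs, hnd, hfs⟩ := hc
    have htree : s.tree = s.cur := if_pos hnew
    obtain ⟨hfb, hfT⟩ := hfs f List.mem_cons_self
    -- The current tree already exists and the flag is set, so `beginUpdate` changes nothing and the
    -- general exchange lemma applies.
    have hupd : ({ s with cur := (insert f s.cur).erase h } : State V) =
        { s.beginUpdate with cur := (insert f s.tree).erase h } := by
      rw [htree, State.beginUpdate]
      have := H.loop.changed.trans hnew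
      cases s
      simp_all
    rw [hupd]
    rw [← htree] at hC hfT
    refine ⟨s₁, s₂, p, b, H.exchange hbg hbbs hfb hfT hC hh fun g hg => List.mem_cons.1 hg, rfl,
      hbg, hbbs, hnd.of_cons, fun g hg => ⟨(hfs g (List.mem_cons_of_mem _ hg)).1, fun hgT => ?_⟩⟩
    rcases Finset.mem_insert.1 (Finset.mem_of_mem_erase hgT) with rfl | hgT
    · exact (List.nodup_cons.1 hnd).1 hg
    · exact (hfs g (List.mem_cons_of_mem _ hg)).2 (htree ▸ hgT)
  | endEdges =>
    obtain ⟨s₁, s₂, p, b, H, -⟩ := hc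
    exact ⟨s₁, s₂, p, H.loop.mono fun f => by simp, H.points, H.isPoint, H.notMem, H.groups⟩
  | endGroups =>
    obtain ⟨s₁, s₂, p, H⟩ := hc
    exact ⟨s₁, s₂, H.loop.mono fun f => by simp [Pending], H.points⟩
  | endTime =>
    obtain ⟨s₁, s₂, H, -⟩ := hc
    exact (H.mono fun f => by simp [Pending]).timesInv
  | @halt s =>
    obtain ⟨htiles, a, hsa, hgap, hM, -⟩ := hc
    exact (htiles.concat (x := ⟨s.prev, s.start, N.K⟩) rfl (hsa.trans_lt hgap.lt)
      hM).isCorrectOutput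

/-- The algorithm gets stuck nowhere. -/
theorem Invariant.exists_step {c : Config V} (hc : Invariant N c) :
    (∃ c', Step N c c') ∨ ∃ out, c = .halted out := by
  cases c with
  | reverseDelete R =>
    left
    obtain ⟨hR, u, hgap, x, hx, hl⟩ := hc
    obtain ⟨D, hD⟩ := STNetwork.exists_isDFSTree hR fun f hf => (hl f hf).mono fun e he => he.1
    by_cases hRD : R ⊆ D
    · obtain ⟨ts, hts, hs⟩ := N.exists_enumerates_isIntersectionTime
      exact ⟨_, .start hD hRD hts hs⟩
    · obtain ⟨f, hfR, hfD⟩ := Finset.not_subset.1 hRD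
      obtain ⟨C, hC⟩ := hD.2.1.exists_isFundamentalCycle (hR hfR) hfD
      obtain ⟨h, hh⟩ := hgap.exists_isHeaviest hC.1.subset_edgeSet ⟨f, hC.2.1⟩
      exact ⟨_, .delete hD hfR hfD hC hh⟩
  | times ts s =>
    left
    cases ts with
    | nil => exact ⟨_, .halt⟩
    | cons t ts =>
      obtain ⟨ps, hps⟩ := exists_enumerates (N.IsIntersectionPoint t)
      exact ⟨_, .beginTime hps⟩
  | points t ps ts s =>
    left
    cases ps with
    | nil => exact ⟨_, .endTime⟩
    | cons p ps =>
      by_cases hpr : AllTreeOrAllNonTree s.prev p ∨ N.InDifferentComponents p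
      · exact ⟨_, .prunePoint hpr⟩
      · obtain ⟨bs, hbs⟩ := exists_enumerates (N.IsGroup p)
        exact ⟨_, .groupPoint hpr hbs⟩
  | groups t bs ps ts s =>
    left
    cases bs with
    | nil => exact ⟨_, .endGroups⟩
    | cons b bs =>
      obtain ⟨s₁, s₂, p, H⟩ := hc
      by_cases hb : AllTreeOrAllNonTree s.prev b
      · exact ⟨_, .pruneGroup hb⟩
      obtain ⟨⟨si, hi⟩, sj, hj⟩ := H.loop.moment.exists_orders fun x hx =>
        H.isPoint.subset_edgeSet ((H.groups.isGroup b List.mem_cons_self).subset hx)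
      by_cases hij : si = sj
      · exact ⟨_, .sameOrder hb hi hj hij⟩
      by_cases hon : ∃ h l, sj = [h, l] ∧ N.OnOnlyTheCommonCycle h l
      · obtain ⟨h, l, hsj, hon⟩ := hon
        exact ⟨_, .swap hb hi hj hij hsj hon⟩
      · exact ⟨_, .beginEdges hb hi hj hij hon⟩
  | edges t fs bs ps ts s =>
    left
    cases fs with
    | nil => exact ⟨_, .endEdges⟩
    | cons f fs =>
      obtain ⟨s₁, s₂, p, b, H, hnew, hbg, -, -, hfs⟩ := hc
      obtain ⟨hfb, hfT⟩ := hfs f List.mem_cons_self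
      have hM := H.loop.isMST
      rw [show s.tree = s.cur from if_pos hnew] at hM
      obtain ⟨C, hC⟩ := hM.1.exists_isFundamentalCycle
        (H.isPoint.subset_edgeSet (hbg.subset hfb)) hfT
      obtain ⟨h, hh⟩ := H.loop.moment.after.exists_isHeaviest hC.1.subset_edgeSet ⟨f, hC.2.1⟩
      exact ⟨_, .addEdge hC hh⟩
  | halted out => exact Or.inr ⟨out, rfl⟩

theorem invariant_initial : Invariant N (initial N) := by
  obtain ⟨ts, hts, hs⟩ := N.exists_enumerates_isIntersectionTime
  have hgap := gap_headD le_rfl N.one_lt_K hs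
    fun y => (hts.2 y).trans ⟨fun h => ⟨h, h.1⟩, fun h => h.1⟩
  obtain ⟨x, hx⟩ := hgap.nonempty
  have hE : ((Set.toFinite N.graph.edgeSet).toFinset : Set (Sym2 V)) = N.graph.edgeSet :=
    Set.Finite.coe_toFinset _
  refine ⟨hE.subset, _, hgap, x, hx, fun f hf => connects_of_mem ⟨?_, le_rfl⟩⟩
  rwa [hE]

end Runs

end EdgeIntersectionOrder

theorem mainTheorem1 {V : Type*} [Fintype V] [DecidableEq V] (N : EdgeIntersectionOrder.STNetwork V) :
    -- every run of the algorithm is finite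
    Acc (fun c' c => EdgeIntersectionOrder.Step N c c') (EdgeIntersectionOrder.initial N) ∧
    -- a run can only end by halting, and then the output is correct
    ∀ c, Relation.ReflTransGen (EdgeIntersectionOrder.Step N) (EdgeIntersectionOrder.initial N) c → (¬ ∃ c', EdgeIntersectionOrder.Step N c c') →
      ∃ out, c = EdgeIntersectionOrder.Config.halted out ∧ EdgeIntersectionOrder.IsCorrectOutput N out := by
  refine ⟨EdgeIntersectionOrder.terminates_reverseDelete _, fun c hrun hstuck => ?_⟩
  have hc : EdgeIntersectionOrder.Invariant N c := by
    clear hstuck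
    induction hrun with
    | refl => exact EdgeIntersectionOrder.invariant_initial
    | tail _ hstep ih => exact hstep.invariant ih
  obtain ⟨out, rfl⟩ := hc.exists_step.resolve_left hstuck
  exact ⟨out, rfl, hc⟩
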